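/- Let $n\ge 3$, let $\sigma$ be the surface measure on $S^{n-1}\subset\mathbb R^n$, $\omega_n=\sigma(S^{n-1})$, and let $L_2(S^{n-1})$ be the real space of $\sigma$-square-integrable functions. Let $W\in C_b(S^{n-1}\times S^{n-1})$ be a rotationally symmetric kernel, $W(x,y)=W(\langle x,y\rangle)$ with a profile $W:[-1,1]\to\mathbb R$. For $k\ge 0$ let $$\hat W_k=c\int_{-1}^1 W(t)\,\frac{C_k^{(n-2)/2}(t)}{C_k^{(n-2)/2}(1)}\,(1-t^2)^{\frac{n-3}{2}}\,dt,\qquad c=\Big(\int_{-1}^1(1-t^2)^{\frac{n-3}{2}}dt\Big)^{-1},$$ where $C_k^\lambda$ are the Gegenbauer polynomials. Fix a pole $e\in S^{n-1}$, let $Y_{k,0}$ be the positive multiple of $x\mapsto C_k^{(n-2)/2}(\langle x,e\rangle)$ with $\frac1{\omega_n}\int Y_{k,0}^2\,d\sigma=1$, and let $L_2^s$ be the closed linear span of $\{Y_{l,0}: l\ge 0\}$ in $L_2(S^{n-1})$. Let $\bar\rho=1/\omega_n$, write $(W*u)(x)=\int W(\langle x,y\rangle)u(y)\,d\sigma(y)$,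 and let $\hat F:L_2(S^{n-1})\times(0,\infty)\to L_2(S^{n-1})$, $$\hat F(u,\gamma)=\bar\rho+u-\frac{e^{-\gamma W*(\bar\rho+u)}}{\int_{S^{n-1}}e^{-\gamma W*(\bar\rho+u)}\,d\sigma},$$ be the Gibbs map shifted to the uniform state $\bar\rho$. Suppose that for some $k\ge1$ we have $\hat W_k<0$ and $\hat W_j\ne\hat W_k$ for all $j\ge1$, $j\ne k$, and put $\gamma_k=-1/\hat W_k$. Then $(0,\gamma_k)$ is a bifurcation point of $\hat F$: the map $\hat F$ is $C^2$, and $(0,\gamma_k)$ lies in the closure of the set of $(u,\gamma)\in L_2(S^{n-1})\times(0,\infty)$ with $\hat F(u,\gamma)=0$ and $u\neq0$. Moreover, there are $\delta>0$ and continuous maps $z:(-\delta,\delta)\to L_2(S^{n-1})$ and $\mu:(-\delta,\delta)\to\mathbb R$ with $z(0)=0$, $\mu(0)=0$ such that, for all $t\in(-\delta,\delta)$, with $$\hat x(t)=tY_{k,0}+tz(t),\qquad \gamma(t)=\gamma_k+\mu(t),$$ one has $\gamma(t)>0$, $\hat F(\hat x(t),\gamma(t))=0$ and $\hat x(t)\in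 L_2^s$; that is, $\bar\rho+\hat x(t)$ is a zero of the Gibbs map at the parameter $\gamma(t)$. -/

import Mathlib

open MeasureTheory Set
open scoped BoundedContinuousFunction

noncomputable section

namespace SphereGibbs

/-! Gegenbauer polynomials and spherical harmonics coefficients -/

/-- The Gegenbauer polynomial `C_k^lam(t)`, through `C_0 = 1`, `C_1 = 2 lam t` and
`(k + 2) C_{k+2} = 2 (lam + k + 1) t C_{k+1} - (2 lam + k) C_k`. -/
def gegenbauer (lam : ℝ) : ℕ → ℝ → ℝ
  | 0, _ => 1
  | 1, t => 2 * lam * t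
  | (k + 2), t =>
      (2 * (lam + k + 1) * t * gegenbauer lam (k + 1) t
        - (2 * lam + k) * gegenbauer lam k t) / (k + 2)

theorem continuous_gegenbauer (lam : ℝ) : ∀ k : ℕ, Continuous (gegenbauer lam k)
  | 0 => by
      have h : gegenbauer lam 0 = fun _ => 1 := by funext t; simp [gegenbauer]
      rw [h]; exact continuous_const
  | 1 => by
      have h : gegenbauer lam 1 = fun t => 2 * lam * t := by funext t; simp [gegenbauer]
      rw [h]; fun_prop
  | (k + 2) => by
      have h1 := continuous_gegenbauer lam (k + 1)
      have h0 := continuous_gegenbauer lam k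
      have h : gegenbauer lam (k + 2) = fun t =>
          (2 * (lam + k + 1) * t * gegenbauer lam (k + 1) t
            - (2 * lam + k) * gegenbauer lam k t) / (k + 2) := by
        funext t; simp [gegenbauer]
      rw [h]; fun_prop

/-- The index `(n - 2) / 2` of the Gegenbauer polynomials that belong to `S^{n-1}`. -/
def gegenbauerIndex (n : ℕ) : ℝ := ((n : ℝ) - 2) / 2

/-- The normalization constant `c_lam = (∫_{-1}^1 (1 - t^2)^(lam - 1/2) dt)⁻¹`. -/
def weightConst (lam : ℝ) : ℝ := (∫ t in (-1 : ℝ)..1, (1 - t ^ 2) ^ (lam - 1 / 2))⁻¹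

/-- The `k`-th coefficient of the spherical harmonics decomposition on `S^{n-1}` of a function
`g` on `[-1, 1]`. -/
def harmonicCoeff (n : ℕ) (g : ℝ → ℝ) (k : ℕ) : ℝ :=
  weightConst (gegenbauerIndex n) *
    ∫ t in (-1 : ℝ)..1,
      g t * (gegenbauer (gegenbauerIndex n) k t / gegenbauer (gegenbauerIndex n) k 1) *
        (1 - t ^ 2) ^ (((n : ℝ) - 3) / 2)

/-! The sphere, its surface measure and its space of square-integrable functions -/

/-- The unit sphere `S^{n-1}` of `ℝ^n`. -/
abbrev Sph (n : ℕ) : Type := Metric.sphere (0 : EuclideanSpace ℝ (Fin n)) 1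

/-- The (unnormalized) surface measure of `S^{n-1}`. -/
abbrev surf (n : ℕ) : Measure (Sph n) :=
  (volume : Measure (EuclideanSpace ℝ (Fin n))).toSphere

/-- The total surface area `ω_n` of `S^{n-1}`. -/
def area (n : ℕ) : ℝ := (surf n).real univ

/-- The real Hilbert space `L_2(S^{n-1})`. -/
abbrev L2 (n : ℕ) : Type := Lp ℝ 2 (surf n)

/-- The class in `L_2(S^{n-1})` of a continuous function. -/
abbrev ofCont (n : ℕ) (f : C(Sph n, ℝ)) : L2 n := ContinuousMap.toLp 2 (surf n) ℝ f

/-- The function `x ↦ C_l^{(n-2)/2}(⟨x, e⟩)`; `⟨x, e⟩` is the cosine of the polar angle of `x`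
with respect to the pole `e`. -/
def zonal (n : ℕ) (e : Sph n) (l : ℕ) : C(Sph n, ℝ) where
  toFun x := gegenbauer (gegenbauerIndex n) l
    (inner ℝ (x : EuclideanSpace ℝ (Fin n)) (e : EuclideanSpace ℝ (Fin n)))
  continuous_toFun := (continuous_gegenbauer _ l).comp
    (Continuous.inner continuous_subtype_val continuous_const)

/-- The spherical harmonic `Y_{l,0}` with pole `e`, normalized for the scalar product
`⟨f, g⟩ = (1 / ω_n) ∫ f g dσ`. -/
def Y (n : ℕ) (e : Sph n) (l : ℕ) : L2 n :=
  (Real.sqrt ((area n)⁻¹ * ∫ x, (zonal n e l x) ^ 2 ∂(surf n)))⁻¹ • ofCont n (zonal n e l)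

/-- The zonal subspace `L_2^s(S^{n-1})`: the closed linear span of the `Y_{l,0}`. -/
def L2s (n : ℕ) (e : Sph n) : Submodule ℝ (L2 n) :=
  (Submodule.span ℝ (range (Y n e))).topologicalClosure

/-! The Gibbs map -/

theorem continuous_conv (n : ℕ) (W : (Sph n × Sph n) →ᵇ ℝ) (u : L2 n) :
    Continuous fun x : Sph n => ∫ y, W (x, y) * u y ∂(surf n) := by
  have hu : Integrable (fun y => u y) (surf n) :=
    (Lp.memLp u).integrable (by norm_num)
  refine continuous_of_dominated (bound := fun y => ‖W‖ * ‖u y‖) ?_ ?_ ?_ ?_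
  · intro x
    have hW : Continuous fun y : Sph n => W (x, y) := by fun_prop
    exact hW.aestronglyMeasurable.mul hu.aestronglyMeasurable
  · intro x
    refine Filter.Eventually.of_forall fun y => ?_
    rw [norm_mul]
    exact mul_le_mul_of_nonneg_right (W.norm_coe_le_norm _) (norm_nonneg _)
  · exact hu.norm.const_mul _
  · refine Filter.Eventually.of_forall fun y => ?_
    fun_prop

/-- The convolution `(W * u)(x) = ∫ W(x, y) u(y) dσ(y)`. -/
def conv (n : ℕ) (W : (Sph n × Sph n) →ᵇ ℝ) (u : L2 n) : C(Sph n, ℝ) where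
  toFun x := ∫ y, W (x, y) * u y ∂(surf n)
  continuous_toFun := continuous_conv n W u

/-- The function `exp(-γ (W * u))`. -/
def expConv (n : ℕ) (W : (Sph n × Sph n) →ᵇ ℝ) (γ : ℝ) (u : L2 n) : C(Sph n, ℝ) where
  toFun x := Real.exp (-γ * conv n W u x)
  continuous_toFun := by fun_prop

/-- The normalization constant `Z(γ, u) = ∫ exp(-γ (W * u)) dσ`. -/
def partitionFn (n : ℕ) (W : (Sph n × Sph n) →ᵇ ℝ) (γ : ℝ) (u : L2 n) : ℝ :=
  ∫ x, expConv n W γ u x ∂(surf n)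

/-- The Gibbs map `F(u, γ) = u - Z(γ, u)⁻¹ exp(-γ (W * u))`, with values in `L_2(S^{n-1})`. -/
def gibbsMap (n : ℕ) (W : (Sph n × Sph n) →ᵇ ℝ) (p : L2 n × ℝ) : L2 n :=
  p.1 - (partitionFn n W p.2 p.1)⁻¹ • ofCont n (expConv n W p.2 p.1)

/-- The uniform state: the constant density `1 / ω_n`. -/
def uniformState (n : ℕ) : L2 n := ofCont n (ContinuousMap.const _ (area n)⁻¹)

/-- The Gibbs map shifted to the uniform state. -/
def shiftedGibbsMap (n : ℕ) (W : (Sph n × Sph n) →ᵇ ℝ) (p : L2 n × ℝ) : L2 n :=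
  gibbsMap n W (uniformState n + p.1, p.2)

/-! Bifurcation points and curves -/

/-- `p₀ = (x₀, lam₀)` is a bifurcation point of the equation `F(x, lam) = 0`, for a `C^2` map `F`
on the open set `D`: it is a limit of solutions `(x, lam)` with `x ≠ x₀`. -/
def IsBifurcationPoint {X : Type*} [NormedAddCommGroup X] [NormedSpace ℝ X]
    (F : X × ℝ → X) (D : Set (X × ℝ)) (p₀ : X × ℝ) : Prop :=
  IsOpen D ∧ p₀ ∈ D ∧ ContDiffOn ℝ 2 F D ∧
    p₀ ∈ closure {p : X × ℝ | p ∈ D ∧ F p = 0 ∧ p.1 ≠ p₀.1}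

/-- `S` is, on `(-ε, ε)`, a bifurcation curve of `F(x, lam) = 0` at the bifurcation point `p₀`. -/
def IsBifurcationCurve {X : Type*} [NormedAddCommGroup X] [NormedSpace ℝ X]
    (F : X × ℝ → X) (D : Set (X × ℝ)) (p₀ : X × ℝ) (ε : ℝ) (S : ℝ → X × ℝ) : Prop :=
  IsBifurcationPoint F D p₀ ∧ 0 < ε ∧ ContinuousOn S (Ioo (-ε) ε) ∧ S 0 = p₀ ∧
    ∀ t ∈ Ioo (-ε) ε, S t ∈ D ∧ F (S t) = 0

end SphereGibbs

end

/-! By the Funk-Hecke formula, convolution with `W` multiplies `Y_{l,0}` by `ω_n Ŵ_l`. On the zonal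
subspace the linearization of the shifted Gibbs map at `(0, γ)` is therefore diagonal, with entry `1
+ γ Ŵ_l` for `l ≥ 1`, and entry `1` for `l = 0` because the normalization removes constants. At
`γ_k` only the entry `l = k` vanishes, and its `γ`-derivative `Ŵ_k` is nonzero: this is bifurcation
from a simple eigenvalue.

The trivial branch is divided out exactly: `F(t x, γ) = t Φ(t, x, γ)` with `Φ` smooth
(`shiftedGibbsMap_smul`, `contDiff_blowUp`). One then solves `Φ(t, Y_k + z, γ_k + μ) = 0` near `t =
0`. A single zonal vector `v` encodes both unknowns: `μ` is its `Y_k`-coefficient and `z` is the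
rest. The derivative in `v` is diagonal with entry `Ŵ_k` at `k`, `1 + γ_k Ŵ_l` at the other `l ≥ 1`,
and `1` at `l = 0` (`exists_solution_curve`). These entries are nonzero and tend to `1`, since `Ŵ_l
→ 0` (`tendsto_harmonicCoeff`), so the derivative is invertible and the implicit function theorem
applies.

Funk-Hecke itself is obtained algebraically. The weighted integral on `[-1, 1]` and the spherical
integral of `p(⟨y, e⟩)` both annihilate `(1 - t^2) p' - (2 lam + 1) t p`. This property fixes a
functional on polynomials up to scale (`functional_unique`) and makes `C_l` orthogonal to lower
degrees. A rotationally symmetric operator is symmetric and does not raise the degree, so `C_l` is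
an eigenvector (`exists_kernel_gegenbauer_eq`). -/

noncomputable section

namespace SphereGibbs

open Polynomial

/-! ### Gegenbauer polynomials as polynomials -/

/-- The Gegenbauer polynomial `C_k^lam` as an element of `ℝ[X]`. -/
def gegenbauerPoly (lam : ℝ) : ℕ → ℝ[X]
  | 0 => 1
  | 1 => C (2 * lam) * X
  | (k + 2) =>
      C ((k + 2 : ℝ)⁻¹) * (C (2 * (lam + k + 1)) * X * gegenbauerPoly lam (k + 1)
        - C (2 * lam + k) * gegenbauerPoly lam k)

theorem eval_gegenbauerPoly (lam t : ℝ) :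
    ∀ k : ℕ, (gegenbauerPoly lam k).eval t = gegenbauer lam k t
  | 0 => by simp [gegenbauerPoly, gegenbauer]
  | 1 => by simp [gegenbauerPoly, gegenbauer]
  | (k + 2) => by
      simp only [gegenbauerPoly, gegenbauer, eval_mul, eval_sub, eval_C, eval_X,
        eval_gegenbauerPoly lam t (k + 1), eval_gegenbauerPoly lam t k]
      ring

theorem gegenbauerPoly_succ_succ (lam : ℝ) (k : ℕ) :
    C (k + 2 : ℝ) * gegenbauerPoly lam (k + 2) =
      C (2 * (lam + k + 1)) * X * gegenbauerPoly lam (k + 1)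
        - C (2 * lam + k) * gegenbauerPoly lam k := by
  have h : (k + 2 : ℝ) ≠ 0 := by positivity
  rw [gegenbauerPoly, ← mul_assoc, ← C_mul, mul_inv_cancel₀ h, C_1, one_mul]

/-- The two identities need a joint induction: differentiating the recurrence and inserting the
second at level `k` gives the first at level `k + 1`, once the factor `k + 2` is cancelled. The
second then follows by elimination. -/
theorem derivative_gegenbauerPoly_succ (lam : ℝ) (k : ℕ) :
    derivative (gegenbauerPoly lam (k + 1)) - X * derivative (gegenbauerPoly lam k) =
        C (2 * lam + k) * gegenbauerPoly lam k ∧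
      X * derivative (gegenbauerPoly lam (k + 1)) - derivative (gegenbauerPoly lam k) =
        C (k + 1 : ℝ) * gegenbauerPoly lam (k + 1) := by
  induction k with
  | zero => simp [gegenbauerPoly, mul_comm]
  | succ k ih =>
    obtain ⟨hA, hB⟩ := ih
    have hk : (C (k + 2 : ℝ) : ℝ[X]) ≠ 0 := by
      rw [Ne, C_eq_zero]; positivity
    have hr := gegenbauerPoly_succ_succ lam k
    have hd := congrArg derivative hr
    simp only [derivative_mul, derivative_sub, derivative_C, derivative_X, zero_mul, zero_add,
      mul_one] at hd
    simp only [Nat.cast_add, Nat.cast_one, C_add, C_mul, C_1] at *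
    have h2 : (C 2 : ℝ[X]) = 2 := rfl
    simp only [h2] at *
    have hA' : derivative (gegenbauerPoly lam (k + 1 + 1))
        - X * derivative (gegenbauerPoly lam (k + 1)) =
        (2 * C lam + (C (k : ℝ) + 1)) * gegenbauerPoly lam (k + 1) := by
      apply mul_left_cancel₀ hk
      linear_combination hd + (2 * C lam + C (k : ℝ)) * hB
    refine ⟨hA', ?_⟩
    linear_combination X * hA' - hA + X * hB - hr

theorem one_sub_sq_mul_derivative_gegenbauerPoly (lam : ℝ) (k : ℕ) :
    (1 - X ^ 2) * derivative (gegenbauerPoly lam (k + 1)) =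
      C (2 * lam + k) * gegenbauerPoly lam k - C (k + 1 : ℝ) * X * gegenbauerPoly lam (k + 1) := by
  obtain ⟨hA, hB⟩ := derivative_gegenbauerPoly_succ lam k
  linear_combination hA - X * hB

/-- The derivative of `p(t) (1 - t^2)^(lam + 1/2)`, divided by `(1 - t^2)^(lam - 1/2)`. -/
def weightDeriv (lam : ℝ) (p : ℝ[X]) : ℝ[X] :=
  (1 - X ^ 2) * derivative p - C (2 * lam + 1) * X * p

/-- This is the Gegenbauer differential equation in divergence form, found by differentiating the
first-order relation above. -/
theorem weightDeriv_derivative_gegenbauerPoly (lam : ℝ) (k : ℕ) :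
    weightDeriv lam (derivative (gegenbauerPoly lam k)) =
      - C (k * (k + 2 * lam)) * gegenbauerPoly lam k := by
  cases k with
  | zero => simp [gegenbauerPoly, weightDeriv]
  | succ k =>
    obtain ⟨hA, hB⟩ := derivative_gegenbauerPoly_succ lam k
    have hd := congrArg derivative (one_sub_sq_mul_derivative_gegenbauerPoly lam k)
    simp only [derivative_mul, derivative_sub, derivative_C, derivative_X, zero_mul, zero_add,
      mul_one, derivative_one, derivative_X_pow, zero_sub] at hd
    unfold weightDeriv
    simp only [Nat.cast_add, Nat.cast_one, C_add, C_mul, C_1] at *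
    have h2 : (C 2 : ℝ[X]) = 2 := rfl
    simp [h2] at *
    linear_combination hd - (2 * C lam + (k : ℝ[X])) * hB

theorem gegenbauerPoly_degree (lam : ℝ) (hlam : 0 < lam) :
    ∀ k, (gegenbauerPoly lam k).natDegree ≤ k ∧ 0 < (gegenbauerPoly lam k).coeff k
  | 0 => by simp [gegenbauerPoly]
  | 1 => by
      refine ⟨(natDegree_C_mul_le _ _).trans natDegree_X_le, ?_⟩
      simpa [gegenbauerPoly] using hlam
  | (k + 2) => by
      obtain ⟨h0, -⟩ := gegenbauerPoly_degree lam hlam k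
      obtain ⟨h1, h1'⟩ := gegenbauerPoly_degree lam hlam (k + 1)
      constructor
      · refine (natDegree_C_mul_le _ _).trans ((natDegree_sub_le _ _).trans (max_le ?_ ?_))
        · refine natDegree_mul_le.trans ?_
          have := (natDegree_C_mul_le (2 * (lam + k + 1)) (X : ℝ[X])).trans natDegree_X_le
          omega
        · exact (natDegree_C_mul_le _ _).trans (h0.trans (by omega))
      · have hz : (gegenbauerPoly lam k).coeff (k + 2) = 0 :=
          coeff_eq_zero_of_natDegree_lt (by omega)
        rw [gegenbauerPoly, coeff_C_mul, coeff_sub, coeff_C_mul, hz, mul_zero, sub_zero,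
          mul_assoc, coeff_C_mul, coeff_X_mul]
        positivity

/-- At `t = 1` the factor `1 - t^2` removes the derivative, leaving `(k + 1) C_{k+1}(1) = (2 lam +
k) C_k(1)`. -/
theorem gegenbauer_one_pos (lam : ℝ) (hlam : 0 < lam) (k : ℕ) : 0 < gegenbauer lam k 1 := by
  induction k with
  | zero => simp [gegenbauer]
  | succ k ih =>
    have h := congrArg (eval 1) (one_sub_sq_mul_derivative_gegenbauerPoly lam k)
    simp only [eval_mul, eval_sub, eval_C, eval_X, eval_one, eval_pow, eval_gegenbauerPoly] at h
    have h' : (k + 1 : ℝ) * gegenbauer lam (k + 1) 1 = (2 * lam + k) * gegenbauer lam k 1 := by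
      linarith
    have : 0 < (k + 1 : ℝ) * gegenbauer lam (k + 1) 1 := by rw [h']; positivity
    exact pos_of_mul_pos_right this (by positivity)

/-! ### Functionals that vanish on total derivatives of the weight -/

theorem functional_X_pow_succ_succ {lam : ℝ} (φ : ℝ[X] →ₗ[ℝ] ℝ)
    (hφ : ∀ p, φ (weightDeriv lam p) = 0) (m : ℕ) :
    (2 * lam + m + 2) * φ (X ^ (m + 2)) = (m + 1) * φ (X ^ m) := by
  have h : weightDeriv lam (X ^ (m + 1)) =
      (m + 1 : ℝ) • X ^ m - (2 * lam + m + 2) • X ^ (m + 2) := by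
    rw [weightDeriv, derivative_X_pow, smul_eq_C_mul, smul_eq_C_mul]
    simp only [C_add, C_mul, C_1, Nat.add_sub_cancel, Nat.cast_add, Nat.cast_one]
    have h2 : (C 2 : ℝ[X]) = 2 := rfl
    simp only [h2]
    ring
  have := hφ (X ^ (m + 1))
  rw [h, map_sub, map_smul, map_smul, smul_eq_mul, smul_eq_mul] at this
  linarith

theorem functional_X_eq_zero {lam : ℝ} (hlam : 0 < lam) (φ : ℝ[X] →ₗ[ℝ] ℝ)
    (hφ : ∀ p, φ (weightDeriv lam p) = 0) : φ X = 0 := by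
  have h : weightDeriv lam 1 = (-(2 * lam + 1)) • X := by
    rw [weightDeriv, smul_eq_C_mul]; simp; ring
  have := hφ 1
  rw [h, map_smul, smul_eq_mul] at this
  rcases mul_eq_zero.mp this with h | h
  · linarith
  · exact h

/-- Testing on powers of `X` gives a two-step recurrence for the moments and kills the first moment,
so all moments are fixed multiples of the zeroth. The cross-multiplied form avoids dividing by `φ 1`
or `ψ 1`. -/
theorem functional_unique {lam : ℝ} (hlam : 0 < lam) (φ ψ : ℝ[X] →ₗ[ℝ] ℝ)
    (hφ : ∀ p, φ (weightDeriv lam p) = 0) (hψ : ∀ p, ψ (weightDeriv lam p) = 0) (p : ℝ[X]) :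
    φ p * ψ 1 = ψ p * φ 1 := by
  have hmono : ∀ m : ℕ, φ (X ^ m) * ψ 1 = ψ (X ^ m) * φ 1 := by
    intro m
    induction m using Nat.twoStepInduction with
    | zero => simp [mul_comm]
    | one => simp [functional_X_eq_zero hlam φ hφ, functional_X_eq_zero hlam ψ hψ]
    | more m ih _ =>
      have h1 := functional_X_pow_succ_succ φ hφ m
      have h2 := functional_X_pow_succ_succ ψ hψ m
      have h : (2 * lam + m + 2) ≠ 0 := by positivity
      apply mul_left_cancel₀ h
      linear_combination ψ 1 * h1 - φ 1 * h2 + (m + 1 : ℝ) * ih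
  have : (LinearMap.mulRight ℝ (ψ 1)) ∘ₗ φ = (LinearMap.mulRight ℝ (φ 1)) ∘ₗ ψ := by
    refine Polynomial.lhom_ext' fun m => LinearMap.ext_ring ?_
    simpa [← X_pow_eq_monomial] using hmono m
  simpa using LinearMap.congr_fun this p

/-- Green's identity: the Gegenbauer operator is symmetric up to a total derivative. `C_l` is an
eigenvector with eigenvalue `-l (l + 2 lam)`, and `X^m` is one with `-m (m + 2 lam)` up to a
multiple of `X^(m-2)`, which the induction handles. The eigenvalues differ for `m < l`. -/
theorem functional_gegenbauerPoly_mul_X_pow {lam : ℝ} (hlam : 0 < lam) (φ : ℝ[X] →ₗ[ℝ] ℝ)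
    (hφ : ∀ p, φ (weightDeriv lam p) = 0) (l m : ℕ) (hm : m < l) :
    φ (gegenbauerPoly lam l * X ^ m) = 0 := by
  induction m using Nat.strong_induction_on with
  | _ m ih =>
    set G := gegenbauerPoly lam l with hG
    have hode := weightDeriv_derivative_gegenbauerPoly lam l
    -- For `m < 2` the exponent `m - 2` truncates to `0`, but the coefficient `m (m - 1)` vanishes.
    have hz : (m : ℝ) * (m - 1) * φ (G * X ^ (m - 2)) = 0 := by
      rcases m with _ | _ | m
      · simp
      · simp
      · rw [show m + 1 + 1 - 2 = m by omega, ih m (by omega) (by omega), mul_zero]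
    -- The Wronskian of `C_l` and `X^m`: its weighted derivative is the difference of the two
    -- second-order expressions.
    have h := hφ (derivative G * X ^ m - G * derivative (X ^ m))
    have hw : weightDeriv lam (derivative G * X ^ m - G * derivative (X ^ m)) =
        (m * (m + 2 * lam) - l * (l + 2 * lam)) • (G * X ^ m)
          - ((m : ℝ) * (m - 1)) • (G * X ^ (m - 2)) := by
      have hX : weightDeriv lam (derivative (X ^ m)) =
          C ((m : ℝ) * (m - 1)) * X ^ (m - 2) - C (m * (m + 2 * lam)) * X ^ m := by
        rcases m with _ | _ | m
        · simp [weightDeriv]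
        · simp [weightDeriv]; ring
        · simp [weightDeriv]
          have h2 : (C 2 : ℝ[X]) = 2 := rfl
          simp only [h2]
          ring
      have h1 : weightDeriv lam (derivative G * X ^ m - G * derivative (X ^ m)) =
          weightDeriv lam (derivative G) * X ^ m - G * weightDeriv lam (derivative (X ^ m)) := by
        simp only [weightDeriv, derivative_sub, derivative_mul]
        ring
      rw [h1, hX, hode, smul_eq_C_mul, smul_eq_C_mul]
      simp only [C_sub]
      ring
    rw [hw, map_sub, map_smul, map_smul, smul_eq_mul, smul_eq_mul, hz, sub_zero] at h
    rcases mul_eq_zero.mp h with h | h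
    · have h1 : (m : ℝ) < l := by exact_mod_cast hm
      have h0 : (0 : ℝ) ≤ m := by positivity
      nlinarith
    · exact h

theorem functional_gegenbauerPoly_mul {lam : ℝ} (hlam : 0 < lam) (φ : ℝ[X] →ₗ[ℝ] ℝ)
    (hφ : ∀ p, φ (weightDeriv lam p) = 0) (l : ℕ) (p : ℝ[X]) (hp : p.degree < l) :
    φ (gegenbauerPoly lam l * p) = 0 := by
  rw [p.as_sum_range_C_mul_X_pow, Finset.mul_sum, map_sum]
  refine Finset.sum_eq_zero fun i _ => ?_
  rw [mul_left_comm, ← smul_eq_C_mul, map_smul, smul_eq_mul]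
  by_cases hi : i < l
  · rw [functional_gegenbauerPoly_mul_X_pow hlam φ hφ l i hi, mul_zero]
  · rw [coeff_eq_zero_of_degree_lt (hp.trans_le (by exact_mod_cast not_lt.mp hi)), zero_mul]

/-- Every polynomial of degree at most `l` is a multiple of `C_l` up to lower degree. -/
theorem exists_eq_smul_gegenbauerPoly_add (lam : ℝ) (hlam : 0 < lam) (l : ℕ) (q : ℝ[X])
    (hq : q.natDegree ≤ l) :
    ∃ (a : ℝ) (r : ℝ[X]), r.degree < l ∧ q = C a * gegenbauerPoly lam l + r := by
  obtain ⟨hd, hc⟩ := gegenbauerPoly_degree lam hlam l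
  refine ⟨q.coeff l / (gegenbauerPoly lam l).coeff l,
    q - C (q.coeff l / (gegenbauerPoly lam l).coeff l) * gegenbauerPoly lam l, ?_, by ring⟩
  rw [degree_lt_iff_coeff_zero]
  intro m hm
  rcases hm.eq_or_lt with rfl | hm
  · rw [coeff_sub, coeff_C_mul, div_mul_cancel₀ _ hc.ne', sub_self]
  · rw [coeff_sub, coeff_C_mul, coeff_eq_zero_of_natDegree_lt (hq.trans_lt hm),
      coeff_eq_zero_of_natDegree_lt (hd.trans_lt hm)]
    simp

/-! ### The weighted integral on `[-1, 1]` -/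

theorem continuous_weight {a : ℝ} (ha : 0 ≤ a) : Continuous fun t : ℝ => (1 - t ^ 2) ^ a := by
  exact Continuous.rpow_const (by fun_prop) fun _ => Or.inr ha

/-- The functional `p ↦ ∫ p(t) (1 - t^2)^(lam - 1/2) dt` on polynomials. -/
def weightFunctional (lam : ℝ) (hlam : 1 / 2 ≤ lam) : ℝ[X] →ₗ[ℝ] ℝ where
  toFun p := ∫ t in (-1 : ℝ)..1, p.eval t * (1 - t ^ 2) ^ (lam - 1 / 2)
  map_add' p q := by
    have hw := continuous_weight (sub_nonneg.mpr hlam)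
    simp only [eval_add, add_mul]
    exact intervalIntegral.integral_add ((p.continuous.mul hw).intervalIntegrable _ _)
      ((q.continuous.mul hw).intervalIntegrable _ _)
  map_smul' c p := by
    simp only [eval_smul, smul_eq_mul, mul_assoc, intervalIntegral.integral_const_mul,
      RingHom.id_apply]

/-- The integrand is the derivative of `p(t) (1 - t^2)^(lam + 1/2)`, which vanishes at both
endpoints. Differentiability is only needed in the open interval. -/
theorem weightFunctional_weightDeriv (lam : ℝ) (hlam : 1 / 2 ≤ lam) (p : ℝ[X]) :
    weightFunctional lam hlam (weightDeriv lam p) = 0 := by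
  have h2 : (0 : ℝ) ≤ lam + 1 / 2 := by linarith
  have hc : Continuous fun t : ℝ => p.eval t * (1 - t ^ 2) ^ (lam + 1 / 2) :=
    p.continuous.mul (continuous_weight h2)
  have h := intervalIntegral.integral_eq_sub_of_hasDerivAt_of_le (a := -1) (b := 1)
    (f := fun t : ℝ => p.eval t * (1 - t ^ 2) ^ (lam + 1 / 2))
    (f' := fun t : ℝ => (weightDeriv lam p).eval t * (1 - t ^ 2) ^ (lam - 1 / 2))
    (by norm_num) hc.continuousOn ?_
    (((weightDeriv lam p).continuous.mul
      (continuous_weight (sub_nonneg.mpr hlam))).intervalIntegrable _ _)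
  · change ∫ t in (-1 : ℝ)..1, _ = _
    rw [h]
    have : lam + 1 / 2 ≠ 0 := by linarith
    norm_num [Real.zero_rpow this]
  · intro t ht
    have hpos : 0 < 1 - t ^ 2 := by nlinarith [ht.1, ht.2]
    have h1 : HasDerivAt (fun t : ℝ => 1 - t ^ 2) (-(2 * t)) t := by
      simpa using ((hasDerivAt_pow 2 t).const_sub 1)
    have h3 := (p.hasDerivAt t).mul (h1.rpow_const (p := lam + 1 / 2) (Or.inl hpos.ne'))
    refine h3.congr_deriv ?_
    have e1 : lam + 1 / 2 - 1 = lam - 1 / 2 := by ring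
    have e2 : (1 - t ^ 2) ^ (lam + 1 / 2) = (1 - t ^ 2) * (1 - t ^ 2) ^ (lam - 1 / 2) := by
      rw [show lam + 1 / 2 = 1 + (lam - 1 / 2) by ring, Real.rpow_add hpos, Real.rpow_one]
    rw [e1, e2]
    simp only [weightDeriv, eval_sub, eval_mul, eval_C, eval_X, eval_one, eval_pow]
    ring

theorem weightFunctional_one_pos (lam : ℝ) (hlam : 1 / 2 ≤ lam) :
    0 < weightFunctional lam hlam 1 := by
  change 0 < ∫ t in (-1 : ℝ)..1, _
  have hw := continuous_weight (sub_nonneg.mpr hlam)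
  simp only [eval_one, one_mul]
  refine intervalIntegral.intervalIntegral_pos_of_pos_on (hw.intervalIntegrable _ _) ?_ (by norm_num)
  intro t ht
  have hpos : 0 < 1 - t ^ 2 := by nlinarith [ht.1, ht.2]
  positivity

/-! ### Rotations -/

/-- Two reflections suffice: the first sends `x` to `a`, the second sends the image of `y` to `b`.
Equality of the inner products says that `a` is orthogonal to the difference being reflected, so the
second fixes `a`. -/
theorem exists_isometry_pair {E : Type*} [NormedAddCommGroup E] [InnerProductSpace ℝ E]
    {x y a b : E} (hx : ‖x‖ = ‖a‖) (hy : ‖y‖ = ‖b‖) (hxy : inner ℝ x y = inner ℝ a b) :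
    ∃ U : E ≃ₗᵢ[ℝ] E, U x = a ∧ U y = b := by
  set R := Submodule.reflection (Submodule.span ℝ {x - a})ᗮ with hR
  have hRx : R x = a := Submodule.reflection_sub hx
  set R' := Submodule.reflection (Submodule.span ℝ {R y - b})ᗮ with hR'
  have hRy : R' (R y) = b := Submodule.reflection_sub (by rw [R.norm_map, hy])
  have hRa : R' a = a := by
    apply Submodule.reflection_mem_subspace_eq_self
    rw [Submodule.mem_orthogonal_singleton_iff_inner_right, inner_sub_left, sub_eq_zero]
    rw [real_inner_comm, ← hRx, R.inner_map_map, hRx, hxy, real_inner_comm]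
  exact ⟨R.trans R', by simp [hRx, hRa], by simp [hRy]⟩

variable {n : ℕ}

/-- The action of a linear isometry on the unit sphere. -/
def sphRot (U : EuclideanSpace ℝ (Fin n) ≃ₗᵢ[ℝ] EuclideanSpace ℝ (Fin n)) : Sph n ≃ₜ Sph n where
  toFun x := ⟨U x, by simp⟩
  invFun x := ⟨U.symm x, by simp⟩
  left_inv x := by simp
  right_inv x := by simp
  continuous_toFun := by fun_prop
  continuous_invFun := by fun_prop

@[simp]
theorem coe_sphRot (U : EuclideanSpace ℝ (Fin n) ≃ₗᵢ[ℝ] EuclideanSpace ℝ (Fin n)) (x : Sph n) :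
    (sphRot U x : EuclideanSpace ℝ (Fin n)) = U x := rfl

-- The surface measure of a set is a multiple of the volume of the cone over it; isometries commute
-- with forming cones and preserve volume.
open scoped Pointwise in
theorem measurePreserving_sphRot
    (U : EuclideanSpace ℝ (Fin n) ≃ₗᵢ[ℝ] EuclideanSpace ℝ (Fin n)) :
    MeasurePreserving (sphRot U) (surf n) (surf n) := by
  refine ⟨(sphRot U).continuous.measurable, ?_⟩
  ext s hs
  have hpre : (Subtype.val '' (sphRot U ⁻¹' s) : Set (EuclideanSpace ℝ (Fin n))) =
      U ⁻¹' (Subtype.val '' s) := by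
    ext v
    constructor
    · rintro ⟨x, hx, rfl⟩
      exact ⟨_, hx, rfl⟩
    · rintro ⟨x, hx, hv⟩
      have hm : v ∈ Metric.sphere (0 : EuclideanSpace ℝ (Fin n)) 1 := by
        have : ‖U v‖ = 1 := by rw [← hv]; simp
        simpa using this
      refine ⟨⟨v, hm⟩, ?_, rfl⟩
      have : sphRot U ⟨v, hm⟩ = x := Subtype.ext hv.symm
      rw [mem_preimage, this]
      exact hx
  have hsm : Ioo (0 : ℝ) 1 • (U ⁻¹' (Subtype.val '' s)) =
      U ⁻¹' (Ioo (0 : ℝ) 1 • (Subtype.val '' s : Set (EuclideanSpace ℝ (Fin n)))) := by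
    ext v
    simp only [Set.mem_smul, mem_preimage]
    constructor
    · rintro ⟨r, hr, w, hw, rfl⟩
      exact ⟨r, hr, U w, hw, by simp⟩
    · rintro ⟨r, hr, w, hw, hv⟩
      refine ⟨r, hr, U.symm w, by simpa using hw, ?_⟩
      rw [← map_smul, hv, U.symm_apply_apply]
  rw [Measure.map_apply (sphRot U).continuous.measurable hs, Measure.toSphere_apply' _ hs,
    Measure.toSphere_apply' _ ((sphRot U).continuous.measurable hs), hpre, hsm]
  congr 1
  exact U.measurePreserving.measure_preimage_emb U.toHomeomorph.measurableEmbedding _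

theorem integral_sphRot (U : EuclideanSpace ℝ (Fin n) ≃ₗᵢ[ℝ] EuclideanSpace ℝ (Fin n))
    (f : Sph n → ℝ) : ∫ x, f (sphRot U x) ∂(surf n) = ∫ x, f x ∂(surf n) :=
  (measurePreserving_sphRot U).integral_comp (sphRot U).measurableEmbedding f

/-- An integral over the sphere that only involves `⟨y, v⟩` and `⟨y, w⟩` depends only on the Gram
matrix of `v` and `w`. -/
theorem integral_inner_pair_eq {v w a b : EuclideanSpace ℝ (Fin n)} (hv : ‖v‖ = ‖a‖)
    (hw : ‖w‖ = ‖b‖) (hvw : inner ℝ v w = inner ℝ a b) (h : ℝ → ℝ → ℝ) :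
    ∫ y : Sph n, h (inner ℝ (y : EuclideanSpace ℝ (Fin n)) v)
        (inner ℝ (y : EuclideanSpace ℝ (Fin n)) w) ∂(surf n) =
      ∫ y : Sph n, h (inner ℝ (y : EuclideanSpace ℝ (Fin n)) a)
        (inner ℝ (y : EuclideanSpace ℝ (Fin n)) b) ∂(surf n) := by
  obtain ⟨U, h1, h2⟩ := exists_isometry_pair hv hw hvw
  rw [← integral_sphRot U (fun y : Sph n => h (inner ℝ (y : EuclideanSpace ℝ (Fin n)) a)
        (inner ℝ (y : EuclideanSpace ℝ (Fin n)) b))]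
  simp only [coe_sphRot, ← h1, ← h2, LinearIsometryEquiv.inner_map_map]

theorem integral_inner_eq {v a : EuclideanSpace ℝ (Fin n)} (hv : ‖v‖ = ‖a‖) (h : ℝ → ℝ) :
    ∫ y : Sph n, h (inner ℝ (y : EuclideanSpace ℝ (Fin n)) v) ∂(surf n) =
      ∫ y : Sph n, h (inner ℝ (y : EuclideanSpace ℝ (Fin n)) a) ∂(surf n) :=
  integral_inner_pair_eq hv hv (by simp [hv]) fun s _ => h s

theorem norm_sph (x : Sph n) : ‖(x : EuclideanSpace ℝ (Fin n))‖ = 1 := by simp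

theorem inner_sph_self (x : Sph n) :
    inner ℝ (x : EuclideanSpace ℝ (Fin n)) (x : EuclideanSpace ℝ (Fin n)) = 1 := by
  rw [real_inner_self_eq_norm_sq, norm_sph, one_pow]

theorem inner_sph_mem (x y : Sph n) :
    inner ℝ (x : EuclideanSpace ℝ (Fin n)) (y : EuclideanSpace ℝ (Fin n)) ∈ Icc (-1 : ℝ) 1 := by
  have := abs_real_inner_le_norm (x : EuclideanSpace ℝ (Fin n)) (y : EuclideanSpace ℝ (Fin n))
  rw [norm_sph, norm_sph, one_mul, abs_le] at this
  exact this

theorem integrable_of_continuous {f : Sph n → ℝ} (hf : Continuous f) : Integrable f (surf n) :=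
  hf.integrable_of_hasCompactSupport (HasCompactSupport.of_compactSpace f)

/-! ### The divergence identity on the sphere -/

theorem hasDerivAt_integral_sph {F F' : ℝ → Sph n → ℝ}
    (hF : Continuous fun q : ℝ × Sph n => F q.1 q.2)
    (hF' : Continuous fun q : ℝ × Sph n => F' q.1 q.2)
    (hd : ∀ θ y, HasDerivAt (fun s => F s y) (F' θ y) θ) (θ : ℝ) :
    HasDerivAt (fun s => ∫ y, F s y ∂(surf n)) (∫ y, F' θ y ∂(surf n)) θ := by
  obtain ⟨B, hB⟩ := ((isCompact_closedBall θ 1).prod (isCompact_univ (X := Sph n))).exists_bound_of_continuousOn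
    hF'.continuousOn
  refine (hasDerivAt_integral_of_dominated_loc_of_deriv_le (F := F) (F' := F')
    (bound := fun _ => B)
    (Metric.closedBall_mem_nhds θ one_pos) ?_ ?_ ?_ ?_ ?_ ?_).2
  · exact Filter.Eventually.of_forall fun s =>
      (hF.comp (Continuous.prodMk_right s)).aestronglyMeasurable
  · exact integrable_of_continuous (hF.comp (Continuous.prodMk_right θ))
  · exact (hF'.comp (Continuous.prodMk_right θ)).aestronglyMeasurable
  · exact Filter.Eventually.of_forall fun y s hs => hB (s, y) ⟨hs, mem_univ _⟩
  · exact integrable_const _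
  · exact Filter.Eventually.of_forall fun y s _ => hd s y

/-- Rotating in the plane of `e` and `f` does not change `∫ p(⟨y, e⟩) ⟨y, f⟩ dσ(y)`; the identity is
the derivative of this constant at angle `0`. -/
theorem integral_rotation_deriv {e f : EuclideanSpace ℝ (Fin n)} (he : ‖e‖ = 1) (hf : ‖f‖ = 1)
    (hef : inner ℝ e f = 0) (p : ℝ[X]) :
    ∫ y : Sph n, ((derivative p).eval (inner ℝ (y : EuclideanSpace ℝ (Fin n)) e) *
        (inner ℝ (y : EuclideanSpace ℝ (Fin n)) f) ^ 2 -
      inner ℝ (y : EuclideanSpace ℝ (Fin n)) e *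
        p.eval (inner ℝ (y : EuclideanSpace ℝ (Fin n)) e)) ∂(surf n) = 0 := by
  set a : Sph n → ℝ := fun y => inner ℝ (y : EuclideanSpace ℝ (Fin n)) e with ha
  set b : Sph n → ℝ := fun y => inner ℝ (y : EuclideanSpace ℝ (Fin n)) f with hb
  have hac : Continuous a := by fun_prop
  have hbc : Continuous b := by fun_prop
  set F : ℝ → Sph n → ℝ := fun θ y =>
    p.eval (Real.cos θ * a y + Real.sin θ * b y) * (-Real.sin θ * a y + Real.cos θ * b y) with hF
  set F' : ℝ → Sph n → ℝ := fun θ y =>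
    (derivative p).eval (Real.cos θ * a y + Real.sin θ * b y) *
      (-Real.sin θ * a y + Real.cos θ * b y) ^ 2 -
      (Real.cos θ * a y + Real.sin θ * b y) *
      p.eval (Real.cos θ * a y + Real.sin θ * b y) with hF'
  have hconst : ∀ θ, ∫ y, F θ y ∂(surf n) = ∫ y, F 0 y ∂(surf n) := by
    intro θ
    have hee : inner ℝ e e = (1 : ℝ) := by rw [real_inner_self_eq_norm_sq, he, one_pow]
    have hff : inner ℝ f f = (1 : ℝ) := by rw [real_inner_self_eq_norm_sq, hf, one_pow]
    have hfe : inner ℝ f e = (0 : ℝ) := by rw [real_inner_comm, hef]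
    have hcs := Real.sin_sq_add_cos_sq θ
    have h1 : ‖Real.cos θ • e + Real.sin θ • f‖ = ‖e‖ := by
      rw [he, ← sq_eq_sq₀ (norm_nonneg _) zero_le_one, ← real_inner_self_eq_norm_sq]
      simp only [inner_add_left, inner_add_right, real_inner_smul_left, real_inner_smul_right,
        hee, hff, hfe, hef]
      linarith
    have h2 : ‖-Real.sin θ • e + Real.cos θ • f‖ = ‖f‖ := by
      rw [hf, ← sq_eq_sq₀ (norm_nonneg _) zero_le_one, ← real_inner_self_eq_norm_sq]
      simp only [inner_add_left, inner_add_right, real_inner_smul_left, real_inner_smul_right,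
        hee, hff, hfe, hef]
      linarith
    have h3 : inner ℝ (Real.cos θ • e + Real.sin θ • f) (-Real.sin θ • e + Real.cos θ • f) =
        inner ℝ e f := by
      simp only [inner_add_left, inner_add_right, real_inner_smul_left, real_inner_smul_right,
        hee, hff, hfe, hef]
      ring
    have := integral_inner_pair_eq h1 h2 h3 (fun s t => p.eval s * t)
    simp only [inner_add_right, real_inner_smul_right] at this
    simpa [hF, ha, hb] using this
  have hd := hasDerivAt_integral_sph (F := F) (F' := F') (by fun_prop) (by fun_prop) (by
    intro θ y
    have h1 : HasDerivAt (fun s => Real.cos s * a y + Real.sin s * b y)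
        (-Real.sin θ * a y + Real.cos θ * b y) θ :=
      ((Real.hasDerivAt_cos θ).mul_const _).add ((Real.hasDerivAt_sin θ).mul_const _)
    have h2 : HasDerivAt (fun s => -Real.sin s * a y + Real.cos s * b y)
        (-Real.cos θ * a y + -Real.sin θ * b y) θ :=
      ((Real.hasDerivAt_sin θ).neg.mul_const _).add ((Real.hasDerivAt_cos θ).mul_const _)
    refine (((p.hasDerivAt _).comp θ h1).mul h2).congr_deriv ?_
    simp only [hF', Function.comp]
    ring) 0
  have h0 : HasDerivAt (fun s => ∫ y, F s y ∂(surf n)) 0 0 := by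
    rw [funext hconst]
    exact hasDerivAt_const _ _
  simpa [hF'] using hd.unique h0

/-- The functional `p ↦ ∫ p(⟨y, e⟩) dσ(y)` on polynomials. -/
def sphFunctional (e : Sph n) : ℝ[X] →ₗ[ℝ] ℝ where
  toFun p := ∫ y : Sph n, p.eval (inner ℝ (y : EuclideanSpace ℝ (Fin n))
    (e : EuclideanSpace ℝ (Fin n))) ∂(surf n)
  map_add' p q := by
    simp only [eval_add]
    exact integral_add (integrable_of_continuous (by fun_prop))
      (integrable_of_continuous (by fun_prop))
  map_smul' c p := by
    simp only [eval_smul, smul_eq_mul, integral_const_mul, RingHom.id_apply]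

theorem sphFunctional_apply (e : Sph n) (p : ℝ[X]) :
    sphFunctional e p = ∫ y : Sph n, p.eval (inner ℝ (y : EuclideanSpace ℝ (Fin n))
      (e : EuclideanSpace ℝ (Fin n))) ∂(surf n) := rfl

/-- Sum the rotation identity over the `n - 1` coordinate directions orthogonal to the pole: the
squares add up to `1 - ⟨y, e⟩^2`, and `n - 1 = 2 lam + 1`. -/
theorem sphFunctional_weightDeriv (e : Sph n) (p : ℝ[X]) :
    sphFunctional e (weightDeriv (gegenbauerIndex n) p) = 0 := by
  classical
  have hne : Nonempty (Fin n) := by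
    by_contra h
    rw [not_nonempty_iff] at h
    have := norm_sph e
    rw [Subsingleton.elim (e : EuclideanSpace ℝ (Fin n)) 0, norm_zero] at this
    exact zero_ne_one this
  obtain ⟨i⟩ := hne
  set e₀ : EuclideanSpace ℝ (Fin n) := EuclideanSpace.single i 1 with he₀
  have hn : ∀ j, ‖(EuclideanSpace.single j 1 : EuclideanSpace ℝ (Fin n))‖ = 1 := by simp
  -- Rotation invariance allows the pole to be a coordinate vector.
  rw [sphFunctional_apply, integral_inner_eq (a := e₀) (by rw [norm_sph, hn])
    (fun s => (weightDeriv (gegenbauerIndex n) p).eval s)]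
  have hsum : ∀ y : Sph n, (weightDeriv (gegenbauerIndex n) p).eval
      (inner ℝ (y : EuclideanSpace ℝ (Fin n)) e₀) =
      ∑ j ∈ Finset.univ.erase i, ((derivative p).eval
        (inner ℝ (y : EuclideanSpace ℝ (Fin n)) e₀) *
        (inner ℝ (y : EuclideanSpace ℝ (Fin n)) (EuclideanSpace.single j 1)) ^ 2 -
        inner ℝ (y : EuclideanSpace ℝ (Fin n)) e₀ *
        p.eval (inner ℝ (y : EuclideanSpace ℝ (Fin n)) e₀)) := by
    intro y
    have hy : ∑ j ∈ Finset.univ.erase i,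
        (inner ℝ (y : EuclideanSpace ℝ (Fin n)) (EuclideanSpace.single j 1)) ^ 2 =
        1 - (inner ℝ (y : EuclideanSpace ℝ (Fin n)) e₀) ^ 2 := by
      have h1 := norm_sph y
      rw [EuclideanSpace.norm_eq, Real.sqrt_eq_one] at h1
      rw [eq_sub_iff_add_eq, he₀, Finset.sum_erase_add _ _ (Finset.mem_univ i)]
      refine Eq.trans ?_ h1
      exact Finset.sum_congr rfl fun j _ => by
        rw [EuclideanSpace.inner_single_right]
        simp
    rw [Finset.sum_sub_distrib, ← Finset.mul_sum, hy, Finset.sum_const,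
      Finset.card_erase_of_mem (Finset.mem_univ i), Finset.card_univ, Fintype.card_fin,
      nsmul_eq_mul, Nat.cast_sub (Nat.one_le_iff_ne_zero.mpr (Fin.pos i).ne')]
    simp only [weightDeriv, gegenbauerIndex, eval_sub, eval_mul, eval_C, eval_X, eval_one,
      eval_pow]
    push_cast
    ring
  simp only [hsum]
  rw [integral_finsetSum _ fun j _ => integrable_of_continuous (by fun_prop)]
  refine Finset.sum_eq_zero fun j hj => integral_rotation_deriv (hn i) (hn j) ?_ p
  have : i ≠ j := (Finset.ne_of_mem_erase hj).symm
  rw [EuclideanSpace.inner_single_left]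
  simp [this]

theorem sphFunctional_one (e : Sph n) : sphFunctional e 1 = area n := by
  simp [sphFunctional_apply, area]

/-! ### Integral operators with rotationally symmetric kernel -/

theorem exists_unit_orthogonal (hn : 2 ≤ n) (e : Sph n) :
    ∃ f : EuclideanSpace ℝ (Fin n), ‖f‖ = 1 ∧ inner ℝ e.1 f = 0 := by
  have hne : (Submodule.span ℝ {e.1})ᗮ ≠ ⊥ := by
    intro h
    rw [Submodule.orthogonal_eq_bot_iff] at h
    have h1 := finrank_span_le_card (R := ℝ) ({e.1} : Set (EuclideanSpace ℝ (Fin n)))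
    rw [h, finrank_top, finrank_euclideanSpace_fin] at h1
    simp at h1
    omega
  obtain ⟨v, hv, hv0⟩ := Submodule.exists_mem_ne_zero_of_ne_bot hne
  refine ⟨‖v‖⁻¹ • v, norm_smul_inv_norm hv0, ?_⟩
  rw [real_inner_smul_right, Submodule.mem_orthogonal_singleton_iff_inner_right.mp hv, mul_zero]

/-- Rotate `x` to `e`. The pole then goes to a unit vector with the same inner product `⟨x, e⟩`,
which may be taken in the plane of `e` and `f`. -/
theorem integral_kernel_eq {e : Sph n} {f : EuclideanSpace ℝ (Fin n)} (hf : ‖f‖ = 1)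
    (hef : inner ℝ e.1 f = 0) (x : Sph n) (w g : ℝ → ℝ) :
    ∫ y : Sph n, w (inner ℝ x.1 y.1) * g (inner ℝ y.1 e.1) ∂(surf n) =
      ∫ y : Sph n, w (inner ℝ y.1 e.1) *
        g (inner ℝ x.1 e.1 * inner ℝ y.1 e.1 +
          Real.sqrt (1 - inner ℝ x.1 e.1 ^ 2) * inner ℝ y.1 f) ∂(surf n) := by
  set t := inner ℝ x.1 e.1 with ht
  have hsq : Real.sqrt (1 - t ^ 2) ^ 2 = 1 - t ^ 2 := by
    apply Real.sq_sqrt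
    have := inner_sph_mem x e
    nlinarith [this.1, this.2]
  have hff : inner ℝ f f = (1 : ℝ) := by rw [real_inner_self_eq_norm_sq, hf, one_pow]
  have hfe : inner ℝ f e.1 = (0 : ℝ) := by rw [real_inner_comm, hef]
  have h1 : ‖e.1‖ = ‖t • e.1 + Real.sqrt (1 - t ^ 2) • f‖ := by
    rw [norm_sph, eq_comm, ← sq_eq_sq₀ (norm_nonneg _) zero_le_one, ← real_inner_self_eq_norm_sq]
    simp only [inner_add_left, inner_add_right, real_inner_smul_left, real_inner_smul_right,
      inner_sph_self, hff, hfe, hef]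
    linarith
  have h2 : inner ℝ x.1 e.1 = inner ℝ e.1 (t • e.1 + Real.sqrt (1 - t ^ 2) • f) := by
    simp only [inner_add_right, real_inner_smul_right, inner_sph_self, hef]
    linarith
  have h := integral_inner_pair_eq (n := n) ((norm_sph x).trans (norm_sph e).symm) h1 h2
    (fun s t => w s * g t)
  simp only [inner_add_right, real_inner_smul_right] at h
  rw [← h]
  exact integral_congr_ae (Filter.Eventually.of_forall fun y => by
    simp only [real_inner_comm])

/-- After the rotation, expand the `m`-th power binomially. Terms with an odd power of `√(1 - t^2)`
carry an odd power of `⟨y, f⟩` and integrate to zero; even powers are polynomials in `t`. -/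
theorem exists_poly_kernel_X_pow (hn : 2 ≤ n) {w : ℝ → ℝ} (hw : Continuous w) (e : Sph n)
    (m : ℕ) : ∃ q : ℝ[X], q.natDegree ≤ m ∧ ∀ x : Sph n,
      ∫ y : Sph n, w (inner ℝ x.1 y.1) * (inner ℝ y.1 e.1) ^ m ∂(surf n) =
        q.eval (inner ℝ x.1 e.1) := by
  obtain ⟨f, hf, hef⟩ := exists_unit_orthogonal hn e
  set I : ℕ → ℝ := fun j => ∫ y : Sph n, w (inner ℝ y.1 e.1) *
    ((inner ℝ y.1 e.1) ^ j * (inner ℝ y.1 f) ^ (m - j)) ∂(surf n) with hI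
  have hodd : ∀ j, Odd (m - j) → I j = 0 := by
    intro j hj
    have h := integral_inner_pair_eq (n := n) (v := e.1) (w := f) (a := e.1) (b := -f) rfl
      (norm_neg f).symm (by rw [inner_neg_right, hef, neg_zero])
      (fun s t => w s * (s ^ j * t ^ (m - j)))
    simp only [inner_neg_right, hj.neg_pow, mul_neg, integral_neg] at h
    simp only [hI]
    linarith
  -- The rounding in `(m - j) / 2` is harmless, since `I j = 0` when `m - j` is odd.
  refine ⟨∑ j ∈ Finset.range (m + 1),
    C (m.choose j * I j) * (X ^ j * (1 - X ^ 2) ^ ((m - j) / 2)), ?_, ?_⟩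
  · refine natDegree_sum_le_of_forall_le _ _ fun j hj => ?_
    refine (natDegree_C_mul_le _ _).trans (natDegree_mul_le.trans ?_)
    have h1 : ((1 : ℝ[X]) - X ^ 2).natDegree ≤ 2 :=
      (natDegree_sub_le _ _).trans (by simp)
    have h2 := natDegree_pow_le_of_le ((m - j) / 2) h1
    rw [natDegree_X_pow]
    have := Finset.mem_range.mp hj
    omega
  · intro x
    set t := inner ℝ x.1 e.1 with ht
    have hsq : Real.sqrt (1 - t ^ 2) ^ 2 = 1 - t ^ 2 := by
      apply Real.sq_sqrt
      have := inner_sph_mem x e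
      nlinarith [this.1, this.2]
    rw [integral_kernel_eq hf hef x w (fun s => s ^ m), ← ht, eval_finsetSum]
    have hexp : ∀ y : Sph n, w (inner ℝ y.1 e.1) *
        (t * inner ℝ y.1 e.1 + Real.sqrt (1 - t ^ 2) * inner ℝ y.1 f) ^ m =
        ∑ j ∈ Finset.range (m + 1), (m.choose j * t ^ j * Real.sqrt (1 - t ^ 2) ^ (m - j)) *
          (w (inner ℝ y.1 e.1) * ((inner ℝ y.1 e.1) ^ j * (inner ℝ y.1 f) ^ (m - j))) := by
      intro y
      rw [add_pow, Finset.mul_sum]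
      refine Finset.sum_congr rfl fun j _ => ?_
      rw [mul_pow, mul_pow]
      ring
    simp only [hexp]
    rw [integral_finsetSum _ fun j _ => integrable_of_continuous (by fun_prop)]
    refine Finset.sum_congr rfl fun j _ => ?_
    rw [integral_const_mul]
    change _ * I j = _
    simp only [eval_mul, eval_C, eval_pow, eval_X, eval_sub, eval_one]
    rcases Nat.even_or_odd (m - j) with h | h
    · have hr : Real.sqrt (1 - t ^ 2) ^ (m - j) = (1 - t ^ 2) ^ ((m - j) / 2) := by
        obtain ⟨r, hr⟩ := h
        rw [hr, ← two_mul, pow_mul, hsq, Nat.mul_div_cancel_left _ two_pos]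
      rw [hr]
      ring
    · rw [hodd j h]
      ring

/-- An integral operator with rotationally symmetric kernel maps zonal polynomials to zonal
polynomials and does not raise the degree. -/
theorem exists_poly_kernel (hn : 2 ≤ n) {w : ℝ → ℝ} (hw : Continuous w) (e : Sph n)
    (d : ℕ) (p : ℝ[X]) (hp : p.degree < d) : ∃ q : ℝ[X], q.degree < d ∧ ∀ x : Sph n,
      ∫ y : Sph n, w (inner ℝ x.1 y.1) * p.eval (inner ℝ y.1 e.1) ∂(surf n) =
        q.eval (inner ℝ x.1 e.1) := by
  choose q hq hqe using fun m => exists_poly_kernel_X_pow hn hw e m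
  refine ⟨∑ m ∈ Finset.range d, C (p.coeff m) * q m, ?_, ?_⟩
  · rw [← mem_degreeLT]
    refine Submodule.sum_mem _ fun m hm => ?_
    rw [mem_degreeLT]
    rw [← smul_eq_C_mul]
    refine (degree_smul_le _ _).trans_lt (degree_le_natDegree.trans_lt ?_)
    have := Finset.mem_range.mp hm
    exact_mod_cast (hq m).trans_lt this
  · intro x
    have hd : ∀ s : ℝ, p.eval s = ∑ m ∈ Finset.range d, p.coeff m * s ^ m := by
      intro s
      rcases eq_or_ne p 0 with rfl | h0
      · simp
      · exact eval_eq_sum_range' ((natDegree_lt_iff_degree_lt h0).mpr hp) s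
    rw [eval_finsetSum]
    simp only [hd, Finset.mul_sum, eval_mul, eval_C, ← hqe, ← integral_const_mul]
    rw [← integral_finsetSum _ fun j _ => integrable_of_continuous (by fun_prop)]
    exact integral_congr_ae (Filter.Eventually.of_forall fun y =>
      Finset.sum_congr rfl fun m _ => by ring)

theorem integral_kernel_symm {w : ℝ → ℝ} (hw : Continuous w) {f g : Sph n → ℝ}
    (hf : Continuous f) (hg : Continuous g) :
    ∫ x : Sph n, (∫ y : Sph n, w (inner ℝ x.1 y.1) * f y ∂(surf n)) * g x ∂(surf n) =
      ∫ x : Sph n, f x * (∫ y : Sph n, w (inner ℝ x.1 y.1) * g y ∂(surf n)) ∂(surf n) := by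
  simp only [← integral_mul_const, ← integral_const_mul]
  rw [integral_integral_swap]
  · refine integral_congr_ae (Filter.Eventually.of_forall fun y => ?_)
    refine integral_congr_ae (Filter.Eventually.of_forall fun x => ?_)
    simp only [real_inner_comm]
    ring
  · exact Continuous.integrable_of_hasCompactSupport
      (f := fun q : Sph n × Sph n => w (inner ℝ q.1.1 q.2.1) * f q.2 * g q.1) (by fun_prop)
      (HasCompactSupport.of_compactSpace _)

theorem gegenbauerIndex_ge (hn : 3 ≤ n) : 1 / 2 ≤ gegenbauerIndex n := by
  have : (3 : ℝ) ≤ n := by exact_mod_cast hn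
  unfold gegenbauerIndex
  linarith

theorem gegenbauerIndex_pos (hn : 3 ≤ n) : 0 < gegenbauerIndex n := by
  linarith [gegenbauerIndex_ge hn]

/-- Write the image of `C_l` as `a C_l + r` with `deg r < l`. By symmetry the image pairs with `r`
as `C_l` pairs with the image of `r`, which has degree below `l`; the pairing is zero. Since `C_l`
is also orthogonal to `r`, the integral of `r^2` vanishes, and by continuity so does `r` on the
sphere. -/
theorem exists_kernel_gegenbauer_eq (hn : 3 ≤ n) {w : ℝ → ℝ} (hw : Continuous w) (e : Sph n)
    (l : ℕ) : ∃ a : ℝ, ∀ x : Sph n,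
      ∫ y : Sph n, w (inner ℝ x.1 y.1) * gegenbauer (gegenbauerIndex n) l (inner ℝ y.1 e.1)
        ∂(surf n) = a * gegenbauer (gegenbauerIndex n) l (inner ℝ x.1 e.1) := by
  have hlam := gegenbauerIndex_pos hn
  set G := gegenbauerPoly (gegenbauerIndex n) l with hG
  have hGe : ∀ s, gegenbauer (gegenbauerIndex n) l s = G.eval s := fun s =>
    (eval_gegenbauerPoly _ _ _).symm
  simp only [hGe]
  obtain ⟨hGd, -⟩ := gegenbauerPoly_degree _ hlam l
  have hort := functional_gegenbauerPoly_mul hlam (sphFunctional e) (sphFunctional_weightDeriv e) l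
  obtain ⟨q, hq, hqe⟩ := exists_poly_kernel (by omega) hw e (l + 1) G
    (degree_le_natDegree.trans_lt (by exact_mod_cast Nat.lt_succ_of_le hGd))
  have hqd : q.natDegree ≤ l := by
    rcases eq_or_ne q 0 with rfl | h0
    · simp
    · exact Nat.lt_succ_iff.mp ((natDegree_lt_iff_degree_lt h0).mpr hq)
  obtain ⟨a, r, hr, hqr⟩ := exists_eq_smul_gegenbauerPoly_add _ hlam l q hqd
  obtain ⟨r', hr', hre⟩ := exists_poly_kernel (by omega) hw e l r hr
  have hzero : sphFunctional e (q * r) = 0 := by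
    have h := integral_kernel_symm (n := n) hw (f := fun y => G.eval (inner ℝ y.1 e.1))
      (g := fun y => r.eval (inner ℝ y.1 e.1)) (by fun_prop) (by fun_prop)
    simp only [hqe, hre] at h
    rw [sphFunctional_apply]
    simp only [eval_mul]
    rw [h]
    have := hort r' hr'
    rw [sphFunctional_apply] at this
    simpa only [eval_mul] using this
  have hrr : sphFunctional e (r * r) = 0 := by
    have : r * r = q * r - a • (G * r) := by rw [hqr, smul_eq_C_mul]; ring
    rw [this, map_sub, map_smul, hzero, hort r hr, smul_zero, sub_zero]
  have hr0 : ∀ x : Sph n, r.eval (inner ℝ x.1 e.1) = 0 := by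
    rw [sphFunctional_apply] at hrr
    have hc : Continuous fun y : Sph n => (r * r).eval (inner ℝ y.1 e.1) := by fun_prop
    intro x
    by_contra hx
    have h0 := (hc.integral_pos_of_hasCompactSupport_nonneg_nonzero (μ := surf n)
      (HasCompactSupport.of_compactSpace _) (fun y => by
        simp only [Pi.zero_apply, eval_mul]; exact mul_self_nonneg _) (x := x) (by simp [hx]))
    exact h0.ne' hrr
  refine ⟨a, fun x => ?_⟩
  rw [hqe, hqr, eval_add, hr0, add_zero, eval_mul, eval_C]

/-! ### Integrals of zonal functions -/

theorem exists_poly_near {g : ℝ → ℝ} (hg : Continuous g) {ε : ℝ} (hε : 0 < ε) :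
    ∃ p : ℝ[X], ∀ t ∈ Icc (-1 : ℝ) 1, |p.eval t - g t| < ε :=
  exists_polynomial_near_of_continuousOn (-1) 1 g hg.continuousOn ε hε

theorem area_nonneg : 0 ≤ area n := measureReal_nonneg

theorem abs_integral_sph_le {f : Sph n → ℝ} {c : ℝ} (hf : ∀ x, |f x| ≤ c) :
    |∫ x, f x ∂(surf n)| ≤ c * area n := by
  rw [← Real.norm_eq_abs, area]
  exact norm_integral_le_of_norm_le_const (μ := surf n) (Filter.Eventually.of_forall hf)

theorem abs_integral_weight_le (lam : ℝ) (hlam : 1 / 2 ≤ lam) {f : ℝ → ℝ} {c : ℝ}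
    (hf : ∀ t ∈ Icc (-1 : ℝ) 1, |f t| ≤ c) :
    |∫ t in (-1 : ℝ)..1, f t * (1 - t ^ 2) ^ (lam - 1 / 2)| ≤
      c * weightFunctional lam hlam 1 := by
  have hw := continuous_weight (sub_nonneg.mpr hlam)
  have h : c * weightFunctional lam hlam 1 =
      ∫ t in (-1 : ℝ)..1, c * (1 - t ^ 2) ^ (lam - 1 / 2) := by
    rw [intervalIntegral.integral_const_mul]
    change _ * (∫ t in (-1 : ℝ)..1, _) = _
    simp
  rw [h]
  have hi : IntervalIntegrable (fun t : ℝ => c * (1 - t ^ 2) ^ (lam - 1 / 2)) volume (-1) 1 :=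
    (hw.const_mul c).intervalIntegrable _ _
  rw [← Real.norm_eq_abs]
  refine intervalIntegral.norm_integral_le_of_norm_le (show (-1 : ℝ) ≤ 1 by norm_num)
    (Filter.Eventually.of_forall fun t ht => ?_) hi
  have hpos : 0 ≤ 1 - t ^ 2 := by nlinarith [ht.1, ht.2]
  have hp : 0 ≤ (1 - t ^ 2) ^ (lam - 1 / 2) := Real.rpow_nonneg hpos _
  rw [Real.norm_eq_abs, abs_mul, abs_of_nonneg hp]
  exact mul_le_mul_of_nonneg_right (hf t ⟨ht.1.le, ht.2⟩) hp

/-- The integral of a zonal function as a weighted integral over `[-1, 1]`. -/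
theorem integral_zonal (hn : 3 ≤ n) (e : Sph n) {g : ℝ → ℝ} (hg : Continuous g) :
    ∫ y : Sph n, g (inner ℝ y.1 e.1) ∂(surf n) =
      area n * (weightConst (gegenbauerIndex n) *
        ∫ t in (-1 : ℝ)..1, g t * (1 - t ^ 2) ^ (gegenbauerIndex n - 1 / 2)) := by
  set lam := gegenbauerIndex n with hl
  have hlam : 1 / 2 ≤ lam := gegenbauerIndex_ge hn
  have hw := continuous_weight (sub_nonneg.mpr hlam)
  set Wt := weightFunctional lam hlam 1 with hWt
  have hWpos : 0 < Wt := weightFunctional_one_pos lam hlam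
  have hc : weightConst lam = Wt⁻¹ := by
    rw [weightConst, hWt]
    change _ = (∫ t in (-1 : ℝ)..1, _)⁻¹
    simp
  set J := ∫ t in (-1 : ℝ)..1, g t * (1 - t ^ 2) ^ (lam - 1 / 2) with hJ
  suffices h : (∫ y : Sph n, g (inner ℝ y.1 e.1) ∂(surf n)) * Wt - J * area n = 0 by
    rw [hc]
    field_simp
    linarith
  rw [← abs_eq_zero]
  refine le_antisymm (le_of_forall_pos_le_add fun ε hε => ?_) (abs_nonneg _)
  rw [zero_add]
  -- Each of the two approximation errors contributes at most `η * area n * Wt`; the `+ 1` keeps the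
  -- denominator positive.
  have hden : 0 < 2 * area n * Wt + 1 := by
    have := area_nonneg (n := n)
    positivity
  obtain ⟨p, hp⟩ := exists_poly_near hg (div_pos hε hden)
  set η := ε / (2 * area n * Wt + 1) with hη
  have huniq := functional_unique (by linarith : 0 < lam) (sphFunctional e)
    (weightFunctional lam hlam) (sphFunctional_weightDeriv e)
    (weightFunctional_weightDeriv lam hlam) p
  rw [sphFunctional_one] at huniq
  have h1 : |(∫ y : Sph n, g (inner ℝ y.1 e.1) ∂(surf n)) - sphFunctional e p| ≤ η * area n := by
    rw [sphFunctional_apply, ← integral_sub (integrable_of_continuous (by fun_prop))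
      (integrable_of_continuous (by fun_prop))]
    exact abs_integral_sph_le fun y => by
      rw [abs_sub_comm]; exact (hp _ (inner_sph_mem y e)).le
  have h2 : |J - weightFunctional lam hlam p| ≤ η * Wt := by
    change |J - ∫ t in (-1 : ℝ)..1, _| ≤ _
    have hi : ∀ {u : ℝ → ℝ}, Continuous u → IntervalIntegrable
        (fun t => u t * (1 - t ^ 2) ^ (lam - 1 / 2)) volume (-1) 1 := fun hu =>
      (hu.mul hw).intervalIntegrable _ _
    rw [hJ, ← intervalIntegral.integral_sub (hi hg) (hi p.continuous)]
    simp only [← sub_mul]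
    exact abs_integral_weight_le lam hlam fun t ht => by
      rw [abs_sub_comm]; exact (hp t ht).le
  have hηe : η * (2 * area n * Wt) ≤ ε := by
    have h0 : 0 ≤ η := (div_pos hε hden).le
    have : η * (2 * area n * Wt + 1) = ε := div_mul_cancel₀ _ hden.ne'
    linarith
  have e1 : (∫ y : Sph n, g (inner ℝ y.1 e.1) ∂(surf n)) * Wt - J * area n =
      ((∫ y : Sph n, g (inner ℝ y.1 e.1) ∂(surf n)) - sphFunctional e p) * Wt -
        (J - weightFunctional lam hlam p) * area n := by
    linear_combination huniq
  rw [e1]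
  refine (abs_sub _ _).trans ?_
  rw [abs_mul, abs_mul, abs_of_pos hWpos, abs_of_nonneg area_nonneg]
  nlinarith [mul_le_mul_of_nonneg_right h1 hWpos.le,
    mul_le_mul_of_nonneg_right h2 (area_nonneg (n := n))]

/-- The Funk-Hecke formula for zonal harmonics. -/
theorem funk_hecke (hn : 3 ≤ n) {w : ℝ → ℝ} (hw : Continuous w) (e : Sph n) (l : ℕ) (x : Sph n) :
    ∫ y : Sph n, w (inner ℝ x.1 y.1) * gegenbauer (gegenbauerIndex n) l (inner ℝ y.1 e.1)
      ∂(surf n) =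
      area n * harmonicCoeff n w l * gegenbauer (gegenbauerIndex n) l (inner ℝ x.1 e.1) := by
  obtain ⟨a, ha⟩ := exists_kernel_gegenbauer_eq hn hw e l
  rw [ha]
  congr 1
  have hpos := gegenbauer_one_pos _ (gegenbauerIndex_pos hn) l
  have hcont := continuous_gegenbauer (gegenbauerIndex n) l
  -- Evaluating at the pole identifies the eigenvalue: the kernel and the harmonic become functions
  -- of the same inner product, and the factor `C_l(1)` is nonzero.
  have h1 := ha e
  rw [inner_sph_self] at h1
  have h2 := integral_zonal hn e (hw.mul hcont)
  simp only [Pi.mul_apply] at h2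
  have h3 : ∫ y : Sph n, w (inner ℝ e.1 y.1) * gegenbauer (gegenbauerIndex n) l (inner ℝ y.1 e.1)
      ∂(surf n) = ∫ y : Sph n, w (inner ℝ y.1 e.1) *
        gegenbauer (gegenbauerIndex n) l (inner ℝ y.1 e.1) ∂(surf n) := by
    simp only [real_inner_comm]
  rw [h3, h2] at h1
  have h4 : harmonicCoeff n w l * gegenbauer (gegenbauerIndex n) l 1 =
      weightConst (gegenbauerIndex n) * ∫ t in (-1 : ℝ)..1,
        w t * gegenbauer (gegenbauerIndex n) l t * (1 - t ^ 2) ^ (gegenbauerIndex n - 1 / 2) := by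
    rw [harmonicCoeff, mul_assoc, ← intervalIntegral.integral_mul_const]
    congr 2
    funext t
    have : gegenbauerIndex n - 1 / 2 = ((n : ℝ) - 3) / 2 := by unfold gegenbauerIndex; ring
    rw [this]
    field_simp
  apply mul_right_cancel₀ hpos.ne'
  rw [← h1, mul_assoc, h4]

theorem area_pos (hn : 3 ≤ n) : 0 < area n := by
  have : Nontrivial (EuclideanSpace ℝ (Fin n)) := by
    apply Module.nontrivial_of_finrank_pos (R := ℝ)
    rw [finrank_euclideanSpace_fin]
    omega
  rw [area, measureReal_def, ENNReal.toReal_pos_iff]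
  exact ⟨Measure.measure_univ_pos.mpr (Measure.toSphere_ne_zero _), measure_lt_top _ _⟩

/-! ### Decay of the harmonic coefficients -/

theorem harmonicCoeff_congr {f g : ℝ → ℝ} (h : ∀ t ∈ Icc (-1 : ℝ) 1, f t = g t) (l : ℕ) :
    harmonicCoeff n f l = harmonicCoeff n g l := by
  unfold harmonicCoeff
  congr 1
  refine intervalIntegral.integral_congr fun t ht => ?_
  rw [uIcc_of_le (by norm_num)] at ht
  simp only [h t ht]

theorem harmonicCoeff_eq (f : ℝ → ℝ) (l : ℕ) :
    harmonicCoeff n f l = (gegenbauer (gegenbauerIndex n) l 1)⁻¹ * (weightConst (gegenbauerIndex n) *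
      ∫ t in (-1 : ℝ)..1, f t * gegenbauer (gegenbauerIndex n) l t *
        (1 - t ^ 2) ^ (gegenbauerIndex n - 1 / 2)) := by
  rw [harmonicCoeff, mul_left_comm, ← intervalIntegral.integral_const_mul (gegenbauer _ l 1)⁻¹]
  congr 2
  funext t
  have : gegenbauerIndex n - 1 / 2 = ((n : ℝ) - 3) / 2 := by unfold gegenbauerIndex; ring
  rw [this]
  ring

theorem harmonicCoeff_sub (hn : 3 ≤ n) {f g : ℝ → ℝ} (hf : Continuous f) (hg : Continuous g)
    (l : ℕ) : harmonicCoeff n (fun t => f t - g t) l =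
      harmonicCoeff n f l - harmonicCoeff n g l := by
  have hw := continuous_weight (sub_nonneg.mpr (gegenbauerIndex_ge hn))
  have hi : ∀ {u : ℝ → ℝ}, Continuous u → IntervalIntegrable
      (fun t => u t * gegenbauer (gegenbauerIndex n) l t *
        (1 - t ^ 2) ^ (gegenbauerIndex n - 1 / 2)) volume (-1) 1 := fun hu =>
    ((hu.mul (continuous_gegenbauer _ l)).mul hw).intervalIntegrable _ _
  simp only [harmonicCoeff_eq, ← mul_sub]
  rw [← intervalIntegral.integral_sub (hi hf) (hi hg)]
  simp only [sub_mul]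

theorem harmonicCoeff_polynomial (hn : 3 ≤ n) (p : ℝ[X]) (l : ℕ) (hp : p.degree < l) :
    harmonicCoeff n (fun t => p.eval t) l = 0 := by
  have hlam := gegenbauerIndex_ge hn
  have h := functional_gegenbauerPoly_mul (gegenbauerIndex_pos hn)
    (weightFunctional _ hlam) (weightFunctional_weightDeriv _ hlam) l p hp
  have h' : ∫ t in (-1 : ℝ)..1, p.eval t * gegenbauer (gegenbauerIndex n) l t *
        (1 - t ^ 2) ^ (gegenbauerIndex n - 1 / 2) = 0 := by
    rw [← h]
    change _ = ∫ t in (-1 : ℝ)..1, _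
    simp only [eval_mul, eval_gegenbauerPoly, mul_comm (p.eval _)]
  rw [harmonicCoeff_eq, h', mul_zero, mul_zero]

/-- Apply Funk-Hecke at a point where the zonal harmonic has maximal modulus and divide by that
maximum: an eigenvalue is bounded by the sup-norm of the operator. -/
theorem abs_harmonicCoeff_le (hn : 3 ≤ n) (e : Sph n) {w : ℝ → ℝ} (hw : Continuous w) {c : ℝ}
    (hc : ∀ t ∈ Icc (-1 : ℝ) 1, |w t| ≤ c) (l : ℕ) : |harmonicCoeff n w l| ≤ c := by
  have harea := area_pos hn
  have hG := continuous_gegenbauer (gegenbauerIndex n) l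
  obtain ⟨x, -, hx⟩ := (isCompact_univ (X := Sph n)).exists_isMaxOn ⟨e, mem_univ _⟩
    (f := fun x : Sph n => |gegenbauer (gegenbauerIndex n) l (inner ℝ x.1 e.1)|)
    (by fun_prop)
  set M := |gegenbauer (gegenbauerIndex n) l (inner ℝ x.1 e.1)| with hM
  have hMle : ∀ y : Sph n, |gegenbauer (gegenbauerIndex n) l (inner ℝ y.1 e.1)| ≤ M :=
    fun y => hx (mem_univ y)
  have hMpos : 0 < M := by
    refine lt_of_lt_of_le ?_ (hMle e)
    rw [inner_sph_self]
    exact abs_pos.mpr (gegenbauer_one_pos _ (gegenbauerIndex_pos hn) l).ne'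
  have hc0 : 0 ≤ c := (abs_nonneg _).trans (hc 0 (by norm_num))
  have h := congrArg abs (funk_hecke hn hw e l x)
  rw [abs_mul, abs_mul, abs_of_pos harea, ← hM] at h
  have h1 : area n * |harmonicCoeff n w l| * M ≤ c * M * area n := by
    rw [← h]
    refine abs_integral_sph_le fun y => ?_
    rw [abs_mul]
    exact mul_le_mul (hc _ (inner_sph_mem x y)) (hMle y) (abs_nonneg _) hc0
  have h2 : |harmonicCoeff n w l| * (area n * M) ≤ c * (area n * M) := by linarith
  exact le_of_mul_le_mul_right h2 (by positivity)

/-- A polynomial has zero coefficients beyond its degree, and the sup-norm controls each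
coefficient, so Weierstrass approximation gives the decay. -/
theorem tendsto_harmonicCoeff (hn : 3 ≤ n) (e : Sph n) {w : ℝ → ℝ} (hw : Continuous w) :
    Filter.Tendsto (harmonicCoeff n w) Filter.atTop (nhds 0) := by
  rw [Metric.tendsto_atTop]
  intro ε hε
  obtain ⟨p, hp⟩ := exists_poly_near hw (half_pos hε)
  refine ⟨p.natDegree + 1, fun l hl => ?_⟩
  have hd : p.degree < l := degree_le_natDegree.trans_lt (by exact_mod_cast hl)
  have h := harmonicCoeff_sub hn hw p.continuous l
  rw [harmonicCoeff_polynomial hn p l hd, sub_zero] at h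
  rw [dist_zero_right, Real.norm_eq_abs, ← h]
  refine (abs_harmonicCoeff_le hn e (hw.sub p.continuous) (c := ε / 2) ?_ l).trans_lt
    (half_lt_self hε)
  intro t ht
  rw [Pi.sub_apply, abs_sub_comm]
  exact (hp t ht).le

/-! ### Zonal functions -/

/-- A continuous section of `x ↦ ⟨x, e⟩`, which turns zonal functions into functions of one
variable. Clamping by `projIcc` makes it defined on all of `ℝ`. -/
theorem exists_meridian (hn : 2 ≤ n) (e : Sph n) :
    ∃ s : ℝ → Sph n, Continuous s ∧
      ∀ t, inner ℝ (s t).1 e.1 = projIcc (-1 : ℝ) 1 (by norm_num) t := by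
  obtain ⟨f, hf, hef⟩ := exists_unit_orthogonal hn e
  set τ : ℝ → ℝ := fun t => projIcc (-1 : ℝ) 1 (by norm_num) t with hτ
  have hτc : Continuous τ := continuous_subtype_val.comp continuous_projIcc
  have hff : inner ℝ f f = (1 : ℝ) := by rw [real_inner_self_eq_norm_sq, hf, one_pow]
  have hfe : inner ℝ f e.1 = (0 : ℝ) := by rw [real_inner_comm, hef]
  have hmem : ∀ t, τ t • e.1 + Real.sqrt (1 - τ t ^ 2) • f ∈
      Metric.sphere (0 : EuclideanSpace ℝ (Fin n)) 1 := by
    intro t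
    have hsq : Real.sqrt (1 - τ t ^ 2) ^ 2 = 1 - τ t ^ 2 := by
      apply Real.sq_sqrt
      have := (projIcc (-1 : ℝ) 1 (by norm_num) t).2
      nlinarith [this.1, this.2]
    rw [mem_sphere_zero_iff_norm, ← sq_eq_sq₀ (norm_nonneg _) zero_le_one,
      ← real_inner_self_eq_norm_sq]
    simp only [inner_add_left, inner_add_right, real_inner_smul_left, real_inner_smul_right,
      inner_sph_self, hff, hfe, hef]
    linarith
  refine ⟨fun t => ⟨_, hmem t⟩, Continuous.subtype_mk (by fun_prop) _, fun t => ?_⟩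
  simp only [inner_add_left, real_inner_smul_left, inner_sph_self, hfe]
  ring

/-- The continuous functions on the sphere that depend only on `⟨x, e⟩`. -/
def zonalCont (e : Sph n) : Submodule ℝ C(Sph n, ℝ) where
  carrier := {f | ∀ x y : Sph n, inner ℝ x.1 e.1 = inner ℝ y.1 e.1 → f x = f y}
  add_mem' hf hg x y h := by simp [hf x y h, hg x y h]
  zero_mem' x y h := rfl
  smul_mem' c f hf x y h := by simp [hf x y h]

theorem isClosed_zonalCont (e : Sph n) : IsClosed (zonalCont e : Set C(Sph n, ℝ)) := by
  have : (zonalCont e : Set C(Sph n, ℝ)) =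
      ⋂ (x : Sph n) (y : Sph n) (_ : inner ℝ x.1 e.1 = inner ℝ y.1 e.1),
        {f : C(Sph n, ℝ) | f x = f y} := by
    ext f
    simp [zonalCont]
  rw [this]
  exact isClosed_iInter fun x => isClosed_iInter fun y => isClosed_iInter fun _ =>
    isClosed_eq (continuous_eval_const x) (continuous_eval_const y)

theorem zonal_mem_zonalCont (e : Sph n) (l : ℕ) : zonal n e l ∈ zonalCont e := fun x y h => by
  simp only [zonal, ContinuousMap.coe_mk, h]

/-- The zonal function `x ↦ p(⟨x, e⟩)` for a polynomial `p`. -/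
def zonalPoly (e : Sph n) (p : ℝ[X]) : C(Sph n, ℝ) where
  toFun x := p.eval (inner ℝ x.1 e.1)
  continuous_toFun := by fun_prop

theorem zonal_eq_zonalPoly (e : Sph n) (l : ℕ) :
    zonal n e l = zonalPoly e (gegenbauerPoly (gegenbauerIndex n) l) := by
  ext x
  simp [zonal, zonalPoly, eval_gegenbauerPoly]

theorem ofCont_zero : ofCont n 0 = 0 := map_zero _

theorem ofCont_add (f g : C(Sph n, ℝ)) : ofCont n (f + g) = ofCont n f + ofCont n g :=
  map_add _ f g

theorem ofCont_smul (c : ℝ) (f : C(Sph n, ℝ)) : ofCont n (c • f) = c • ofCont n f :=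
  map_smul _ c f

theorem inner_ofCont (f g : C(Sph n, ℝ)) :
    inner ℝ (ofCont n f) (ofCont n g) = ∫ x, f x * g x ∂(surf n) := by
  rw [MeasureTheory.L2.inner_def]
  refine integral_congr_ae ?_
  filter_upwards [ContinuousMap.coeFn_toLp (p := 2) (𝕜 := ℝ) (surf n) f,
    ContinuousMap.coeFn_toLp (p := 2) (𝕜 := ℝ) (surf n) g] with x hf hg
  rw [hf, hg]
  simp [mul_comm]

/-- The factor that normalizes `Y_{l,0}`. -/
def normConst (n : ℕ) (e : Sph n) (l : ℕ) : ℝ :=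
  (Real.sqrt ((area n)⁻¹ * ∫ x, (zonal n e l x) ^ 2 ∂(surf n)))⁻¹

theorem Y_eq (e : Sph n) (l : ℕ) : Y n e l = normConst n e l • ofCont n (zonal n e l) := rfl

theorem integral_zonal_sq_pos (hn : 3 ≤ n) (e : Sph n) (l : ℕ) :
    0 < ∫ x, (zonal n e l x) ^ 2 ∂(surf n) := by
  have hc : Continuous fun x => (zonal n e l x) ^ 2 := by fun_prop
  refine hc.integral_pos_of_hasCompactSupport_nonneg_nonzero
    (HasCompactSupport.of_compactSpace _) (fun x => sq_nonneg _) (x := e) ?_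
  have := gegenbauer_one_pos _ (gegenbauerIndex_pos hn) l
  simp only [zonal, ContinuousMap.coe_mk, inner_sph_self]
  positivity

theorem normConst_pos (hn : 3 ≤ n) (e : Sph n) (l : ℕ) : 0 < normConst n e l := by
  have h1 := area_pos hn
  have h2 := integral_zonal_sq_pos hn e l
  unfold normConst
  positivity

theorem inner_Y (hn : 3 ≤ n) (e : Sph n) (l m : ℕ) :
    inner ℝ (Y n e l) (Y n e m) = if l = m then area n else 0 := by
  have harea := area_pos hn
  rw [Y_eq, Y_eq, real_inner_smul_left, real_inner_smul_right, inner_ofCont]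
  have hne : ∀ l m : ℕ, m < l → ∫ x, zonal n e l x * zonal n e m x ∂(surf n) = 0 := by
    intro l m hm
    have hlam := gegenbauerIndex_pos hn
    have h := functional_gegenbauerPoly_mul hlam (sphFunctional e) (sphFunctional_weightDeriv e) l
      (gegenbauerPoly (gegenbauerIndex n) m) (degree_le_natDegree.trans_lt (by
        exact_mod_cast (gegenbauerPoly_degree _ hlam m).1.trans_lt hm))
    rw [sphFunctional_apply] at h
    rw [← h]
    simp [zonal_eq_zonalPoly, zonalPoly]
  rcases lt_trichotomy l m with h | h | h
  · rw [if_neg h.ne]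
    simp only [mul_comm (zonal n e l _)]
    rw [hne m l h, mul_zero, mul_zero]
  · subst h
    have h2 := integral_zonal_sq_pos hn e l
    rw [if_pos rfl]
    simp only [← pow_two]
    rw [normConst, ← mul_assoc, ← mul_inv, Real.mul_self_sqrt (by positivity)]
    field_simp
  · rw [if_neg h.ne', hne l m h, mul_zero, mul_zero]

theorem ofCont_zonalPoly_mem (hn : 3 ≤ n) (e : Sph n) (p : ℝ[X]) :
    ofCont n (zonalPoly e p) ∈ Submodule.span ℝ (range (Y n e)) := by
  have hlam := gegenbauerIndex_pos hn
  have key : ∀ d : ℕ, ∀ p : ℝ[X], p.degree < d →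
      ofCont n (zonalPoly e p) ∈ Submodule.span ℝ (range (Y n e)) := by
    intro d
    induction d with
    | zero =>
      intro p hp
      have : p = 0 := by
        rw [← degree_eq_bot]
        exact Nat.WithBot.lt_zero_iff.mp (by simpa using hp)
      have h0 : zonalPoly e (0 : ℝ[X]) = 0 := by ext x; simp [zonalPoly]
      rw [this, h0, ofCont_zero]
      exact Submodule.zero_mem _
    | succ d ih =>
      intro p hp
      have hpd : p.natDegree ≤ d := by
        rcases eq_or_ne p 0 with rfl | h0
        · simp
        · exact Nat.lt_succ_iff.mp ((natDegree_lt_iff_degree_lt h0).mpr hp)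
      obtain ⟨a, r, hr, rfl⟩ := exists_eq_smul_gegenbauerPoly_add _ hlam d p hpd
      have h1 : zonalPoly e (C a * gegenbauerPoly (gegenbauerIndex n) d + r) =
          a • zonal n e d + zonalPoly e r := by
        ext x
        simp [zonal_eq_zonalPoly, zonalPoly]
      have h2 : ofCont n (zonal n e d) = (normConst n e d)⁻¹ • Y n e d := by
        rw [Y_eq, smul_smul, inv_mul_cancel₀ (normConst_pos hn e d).ne', one_smul]
      rw [h1, ofCont_add, ofCont_smul, h2]
      exact Submodule.add_mem _ (Submodule.smul_mem _ _ (Submodule.smul_mem _ _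
        (Submodule.subset_span ⟨d, rfl⟩))) (ih r hr)
  exact key (p.natDegree + 1) p (degree_le_natDegree.trans_lt (by exact_mod_cast Nat.lt_succ_self _))

/-- Pull `f` back along the meridian and approximate it by polynomials uniformly on `[-1, 1]`; zonal
polynomials lie in the span of the `Y_{l,0}`. -/
theorem ofCont_mem_L2s (hn : 3 ≤ n) (e : Sph n) {f : C(Sph n, ℝ)} (hf : f ∈ zonalCont e) :
    ofCont n f ∈ L2s n e := by
  obtain ⟨s, hs, hse⟩ := exists_meridian (by omega : 2 ≤ n) e
  have hfs : ∀ x : Sph n, f x = f (s (inner ℝ x.1 e.1)) := fun x => by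
    apply hf
    rw [hse, projIcc_of_mem _ (inner_sph_mem x e)]
  have hcl : f ∈ closure (range (zonalPoly e)) := by
    rw [Metric.mem_closure_iff]
    intro ε hε
    obtain ⟨p, hp⟩ := exists_poly_near (f.continuous.comp hs) hε
    refine ⟨_, ⟨p, rfl⟩, ?_⟩
    rw [ContinuousMap.dist_lt_iff hε]
    intro x
    rw [hfs x, dist_comm]
    exact hp _ (inner_sph_mem x e)
  have hclosed : IsClosed (ofCont n ⁻¹' (L2s n e : Set (L2 n))) :=
    (Submodule.isClosed_topologicalClosure _).preimage
      (ContinuousMap.toLp 2 (surf n) ℝ : C(Sph n, ℝ) →L[ℝ] L2 n).continuous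
  refine closure_minimal ?_ hclosed hcl
  rintro _ ⟨p, rfl⟩
  exact Submodule.le_topologicalClosure _ (ofCont_zonalPoly_mem hn e p)

theorem Y_mem_L2s (e : Sph n) (l : ℕ) : Y n e l ∈ L2s n e :=
  Submodule.le_topologicalClosure _ (Submodule.subset_span ⟨l, rfl⟩)

/-! ### The convolution as a bounded operator -/

/-- The function `y ↦ W(x, y)`. -/
def kernelSlice (W : (Sph n × Sph n) →ᵇ ℝ) (x : Sph n) : C(Sph n, ℝ) where
  toFun y := W (x, y)
  continuous_toFun := by fun_prop

theorem conv_apply_eq_inner (W : (Sph n × Sph n) →ᵇ ℝ) (u : L2 n) (x : Sph n) :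
    conv n W u x = inner ℝ (ofCont n (kernelSlice W x)) u := by
  rw [MeasureTheory.L2.inner_def]
  refine integral_congr_ae ?_
  filter_upwards [ContinuousMap.coeFn_toLp (p := 2) (𝕜 := ℝ) (surf n) (kernelSlice W x)] with y hy
  rw [hy]
  simp [kernelSlice, mul_comm]

/-- The convolution as a bounded operator from `L_2` to the continuous functions. -/
def convL (W : (Sph n × Sph n) →ᵇ ℝ) : L2 n →L[ℝ] C(Sph n, ℝ) :=
  LinearMap.mkContinuous
    { toFun := conv n W
      map_add' := fun u v => by
        ext x
        simp only [ContinuousMap.add_apply, conv_apply_eq_inner, inner_add_right]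
      map_smul' := fun c u => by
        ext x
        simp only [ContinuousMap.smul_apply, conv_apply_eq_inner, real_inner_smul_right,
          RingHom.id_apply, smul_eq_mul] }
    (‖(ContinuousMap.toLp 2 (surf n) ℝ : C(Sph n, ℝ) →L[ℝ] L2 n)‖ * ‖W‖) fun u => by
      rw [ContinuousMap.norm_le _ (by positivity)]
      intro x
      change ‖conv n W u x‖ ≤ _
      rw [conv_apply_eq_inner]
      refine (norm_inner_le_norm _ _).trans (mul_le_mul_of_nonneg_right ?_ (norm_nonneg _))
      refine (ContinuousLinearMap.le_opNorm _ _).trans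
        (mul_le_mul_of_nonneg_left ?_ (norm_nonneg _))
      rw [ContinuousMap.norm_le _ (norm_nonneg _)]
      exact fun y => W.norm_coe_le_norm (x, y)

theorem convL_apply (W : (Sph n × Sph n) →ᵇ ℝ) (u : L2 n) : convL W u = conv n W u := rfl

theorem convL_ofCont_apply (W : (Sph n × Sph n) →ᵇ ℝ) (f : C(Sph n, ℝ)) (x : Sph n) :
    convL W (ofCont n f) x = ∫ y, W (x, y) * f y ∂(surf n) := by
  rw [convL_apply, conv_apply_eq_inner, inner_ofCont]
  rfl

section Kernel

variable {W : (Sph n × Sph n) →ᵇ ℝ} {w : ℝ → ℝ}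
  (hW : ∀ x y : Sph n, W (x, y) = w (inner ℝ x.1 y.1))

include hW

theorem convL_zonal (hn : 3 ≤ n) (hw : Continuous w) (e : Sph n) (l : ℕ) :
    convL W (ofCont n (zonal n e l)) = (area n * harmonicCoeff n w l) • zonal n e l := by
  ext x
  rw [convL_ofCont_apply]
  simp only [hW]
  exact funk_hecke hn hw e l x

theorem convL_Y (hn : 3 ≤ n) (hw : Continuous w) (e : Sph n) (l : ℕ) :
    convL W (Y n e l) = (normConst n e l * (area n * harmonicCoeff n w l)) • zonal n e l := by
  rw [Y_eq, map_smul, convL_zonal hW hn hw, smul_smul]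

theorem convL_mem_zonalCont (hn : 3 ≤ n) (hw : Continuous w) (e : Sph n) {u : L2 n}
    (hu : u ∈ L2s n e) : convL W u ∈ zonalCont e := by
  have hle : L2s n e ≤ (zonalCont e).comap (convL W : L2 n →ₗ[ℝ] C(Sph n, ℝ)) := by
    refine Submodule.topologicalClosure_minimal _ (Submodule.span_le.mpr ?_)
      ((isClosed_zonalCont e).preimage (convL W).continuous)
    rintro _ ⟨l, rfl⟩
    change convL W (Y n e l) ∈ zonalCont e
    rw [convL_Y hW hn hw]
    exact Submodule.smul_mem _ _ (zonal_mem_zonalCont e l)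
  exact hle hu

end Kernel

/-- Only the values of `w` on `[-1, 1]` are tied to `W`; reading `W` along a meridian gives a
profile continuous on all of `ℝ` with the same coefficients. -/
theorem exists_continuous_profile (hn : 3 ≤ n) (e : Sph n) {W : (Sph n × Sph n) →ᵇ ℝ} {w : ℝ → ℝ}
    (hW : ∀ x y : Sph n, W (x, y) = w (inner ℝ x.1 y.1)) :
    ∃ v : ℝ → ℝ, Continuous v ∧ (∀ x y : Sph n, W (x, y) = v (inner ℝ x.1 y.1)) ∧
      ∀ l, harmonicCoeff n v l = harmonicCoeff n w l := by
  obtain ⟨s, hs, hse⟩ := exists_meridian (by omega : 2 ≤ n) e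
  have hv : ∀ t ∈ Icc (-1 : ℝ) 1, W (s t, e) = w t := fun t ht => by
    rw [hW, hse, projIcc_of_mem _ ht]
  refine ⟨fun t => W (s t, e), by fun_prop, fun x y => ?_, fun l => harmonicCoeff_congr hv l⟩
  exact (hW x y).trans (hv _ (inner_sph_mem x y)).symm

/-! ### The divided exponential -/

section ExpQuot

variable {A : Type*} [NormedCommRing A] [NormedAlgebra ℝ A]

/-- The entire function `(exp x - 1) / x` on a Banach algebra. -/
def expQuot (x : A) : A :=
  FormalMultilinearSeries.ofScalarsSum (fun k : ℕ => (((k + 1).factorial : ℝ))⁻¹) x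

theorem radius_expQuot (A : Type*) [NormedCommRing A] [NormedAlgebra ℝ A] :
    (FormalMultilinearSeries.ofScalars A (fun k : ℕ => (((k + 1).factorial : ℝ))⁻¹)).radius =
      ⊤ := by
  refine FormalMultilinearSeries.ofScalars_radius_eq_top_of_tendsto A _
    (Filter.Eventually.of_forall fun k => by positivity) ?_
  have h : (fun k : ℕ => ‖(((k.succ + 1).factorial : ℝ))⁻¹‖ / ‖(((k + 1).factorial : ℝ))⁻¹‖) =
      fun k : ℕ => 1 / (((k + 1 : ℕ) : ℝ) + 1) := by
    funext k
    have h1 : ((k + 1).factorial : ℝ) ≠ 0 := by positivity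
    rw [norm_inv, norm_inv, Real.norm_natCast, Real.norm_natCast, Nat.succ_eq_add_one,
      Nat.factorial_succ (k + 1)]
    push_cast
    field_simp
  rw [h]
  exact (tendsto_one_div_add_atTop_nhds_zero_nat (𝕜 := ℝ)).comp (Filter.tendsto_add_atTop_nat 1)

variable [CompleteSpace A]

theorem hasSum_expQuot (x : A) :
    HasSum (fun k : ℕ => (((k + 1).factorial : ℝ))⁻¹ • x ^ k) (expQuot x) := by
  have h := FormalMultilinearSeries.hasSum
    (FormalMultilinearSeries.ofScalars A (fun k : ℕ => (((k + 1).factorial : ℝ))⁻¹)) (x := x)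
    (by rw [radius_expQuot]; simp)
  simpa only [FormalMultilinearSeries.ofScalars_apply_eq] using! h

theorem contDiff_expQuot {m : WithTop ℕ∞} : ContDiff ℝ m (expQuot : A → A) := by
  have h := FormalMultilinearSeries.hasFPowerSeriesOnBall
    (FormalMultilinearSeries.ofScalars A (fun k : ℕ => (((k + 1).factorial : ℝ))⁻¹))
    (by rw [radius_expQuot]; simp)
  rw [radius_expQuot] at h
  have h' : AnalyticOnNhd ℝ (expQuot : A → A) univ := by
    have := h.analyticOnNhd
    rwa [Metric.eball_top] at this
  exact h'.contDiff

end ExpQuot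

theorem one_add_mul_expQuot (r : ℝ) : 1 + r * expQuot r = Real.exp r := by
  have h1 : HasSum (fun k : ℕ => ((k.factorial : ℝ))⁻¹ • r ^ k) (Real.exp r) := by
    rw [Real.exp_eq_exp_ℝ]
    exact NormedSpace.exp_series_hasSum_exp' (𝕂 := ℝ) r
  have h2 := (hasSum_nat_add_iff' (f := fun k : ℕ => ((k.factorial : ℝ))⁻¹ • r ^ k) 1).mpr h1
  have h3 := (hasSum_expQuot r).mul_left r
  have h4 : (fun k : ℕ => r * ((((k + 1).factorial : ℝ))⁻¹ • r ^ k)) =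
      fun k : ℕ => (((k + 1).factorial : ℝ))⁻¹ • r ^ (k + 1) := by
    funext k
    simp only [smul_eq_mul]
    ring
  rw [h4] at h3
  have := h3.unique h2
  simp only [Finset.range_one, Finset.sum_singleton, Nat.factorial_zero, Nat.cast_one, inv_one,
    pow_zero, smul_eq_mul, mul_one] at this
  linarith

@[simp]
theorem expQuot_zero {A : Type*} [NormedCommRing A] [NormedAlgebra ℝ A] :
    expQuot (0 : A) = 1 := by
  simp [expQuot]

/-- Evaluation at a point is a continuous algebra homomorphism, so it passes through the power
series. -/
theorem expQuot_apply {S : Type*} [TopologicalSpace S] [CompactSpace S] (f : C(S, ℝ)) (x : S) :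
    expQuot f x = expQuot (f x) := by
  have h := (hasSum_expQuot f).map (ContinuousMap.evalCLM ℝ x : C(S, ℝ) →L[ℝ] ℝ)
    (ContinuousMap.evalCLM ℝ x : C(S, ℝ) →L[ℝ] ℝ).continuous
  exact h.unique (hasSum_expQuot (f x))

/-! ### Diagonal operators and an implicit function theorem -/

/-- `D` multiplies the `i`-th coordinate by `d i`. Dividing by `d i` costs at most `1 / c`, so
square-summability survives. -/
theorem bijective_of_diagonal {X : Type*} [NormedAddCommGroup X] [InnerProductSpace ℝ X]
    [CompleteSpace X] (b : HilbertBasis ℕ ℝ X) (D : X →L[ℝ] X) (d : ℕ → ℝ)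
    (hD : ∀ i, D (b i) = d i • b i) {c : ℝ} (hc : 0 < c) (hd : ∀ i, c ≤ |d i|) :
    Function.Bijective D := by
  have hd0 : ∀ i, d i ≠ 0 := fun i => abs_pos.mp (hc.trans_le (hd i))
  have hcoord : ∀ x i, b.repr (D x) i = d i * b.repr x i := by
    intro x i
    have h1 := (b.hasSum_repr x).map D D.continuous
    have h2 := h1.map (innerSL ℝ (b i)) (innerSL ℝ (b i)).continuous
    have h3 := ((b.hasSum_repr x).map (innerSL ℝ (b i)) (innerSL ℝ (b i)).continuous).mul_left (d i)
    rw [b.repr_apply_apply, b.repr_apply_apply]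
    refine h2.unique (Eq.mp (congrArg (HasSum · _) (funext fun j => ?_)) h3)
    simp only [Function.comp, map_smul, hD, smul_eq_mul, innerSL_apply_apply]
    rcases eq_or_ne i j with rfl | hij
    · ring
    · rw [b.orthonormal.2 hij]
      ring
  constructor
  · intro x y hxy
    apply b.repr.injective
    ext i
    apply mul_left_cancel₀ (hd0 i)
    rw [← hcoord, ← hcoord, hxy]
  · intro y
    have hmem : Memℓp (fun i => (d i)⁻¹ * b.repr y i) 2 := by
      refine ((lp.memℓp (b.repr y)).const_smul c⁻¹).mono' fun i => ?_
      rw [Pi.smul_apply, norm_mul, norm_smul, norm_inv, norm_inv, Real.norm_of_nonneg hc.le]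
      exact mul_le_mul_of_nonneg_right (inv_anti₀ hc (hd i)) (norm_nonneg _)
    refine ⟨b.repr.symm ⟨_, hmem⟩, ?_⟩
    apply b.repr.injective
    ext i
    rw [hcoord, b.repr.apply_symm_apply]
    exact mul_inv_cancel_left₀ (hd0 i) _

theorem exists_implicit_curve {X : Type*} [NormedAddCommGroup X] [NormedSpace ℝ X]
    [CompleteSpace X] {Ψ : ℝ × X → X} (hΨ : ContDiff ℝ 1 Ψ) (h0 : Ψ 0 = 0) {D : X →L[ℝ] X}
    (hD : HasFDerivAt (fun v => Ψ (0, v)) D 0) (hbij : Function.Bijective D) :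
    ∃ δ > 0, ∃ v : ℝ → X, ContinuousOn v (Ioo (-δ) δ) ∧ v 0 = 0 ∧
      ∀ t ∈ Ioo (-δ) δ, Ψ (t, v t) = 0 := by
  have hcd : ContDiffAt ℝ 1 Ψ ((0 : ℝ), (0 : X)) := hΨ.contDiffAt
  have hcomp : fderiv ℝ Ψ ((0 : ℝ), (0 : X)) ∘L .inr ℝ ℝ X = D := by
    have h1 : HasFDerivAt Ψ (fderiv ℝ Ψ ((0 : ℝ), (0 : X))) ((0 : ℝ), (0 : X)) :=
      (hcd.differentiableAt one_ne_zero).hasFDerivAt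
    exact (h1.comp (0 : X) (hasFDerivAt_prodMk_right (0 : ℝ) (0 : X))).unique hD
  have hinv : (fderiv ℝ Ψ ((0 : ℝ), (0 : X)) ∘L .inr ℝ ℝ X).IsInvertible := by
    rw [hcomp]
    exact ⟨ContinuousLinearEquiv.ofBijective D (LinearMap.ker_eq_bot.mpr hbij.1)
      (LinearMap.range_eq_top.mpr hbij.2), ContinuousLinearEquiv.coe_ofBijective _ _ _⟩
  have hev := hcd.eventually_apply_implicitFunction one_ne_zero hinv
  have hcont := (hcd.contDiffAt_implicitFunction one_ne_zero hinv).eventually (by simp)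
  have h00 := hcd.implicitFunction_apply_self one_ne_zero hinv
  obtain ⟨δ, hδ, hball⟩ := Metric.eventually_nhds_iff_ball.mp (hev.and hcont)
  have hI : Ioo (-δ) δ = Metric.ball (0 : ℝ) δ := by rw [Real.ball_eq_Ioo]; simp
  refine ⟨δ, hδ, hcd.implicitFunction one_ne_zero hinv, ?_, h00, ?_⟩
  · rw [hI]
    exact fun t ht => ((hball t ht).2.continuousAt).continuousWithinAt
  · rw [hI]
    exact fun t ht => ((hball t ht).1).trans h0

/-! ### The Gibbs map in terms of bounded operators -/

/-- The inclusion of the continuous functions into `L_2`. -/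
def ofContL (n : ℕ) : C(Sph n, ℝ) →L[ℝ] L2 n := ContinuousMap.toLp 2 (surf n) ℝ

theorem ofContL_apply (f : C(Sph n, ℝ)) : ofContL n f = ofCont n f := rfl

/-- Integration over the sphere as a bounded functional on the continuous functions. -/
def intL (n : ℕ) : C(Sph n, ℝ) →L[ℝ] ℝ := (innerSL ℝ (ofCont n 1)) ∘L ofContL n

theorem intL_apply (f : C(Sph n, ℝ)) : intL n f = ∫ x, f x ∂(surf n) := by
  change inner ℝ (ofCont n 1) (ofCont n f) = _
  rw [inner_ofCont]
  simp

theorem intL_one : intL n 1 = area n := by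
  simp [intL_apply, area]

/-- The exponential on the continuous functions. -/
def expMap (f : C(Sph n, ℝ)) : C(Sph n, ℝ) := 1 + f * expQuot f

theorem expMap_apply (f : C(Sph n, ℝ)) (x : Sph n) : expMap f x = Real.exp (f x) := by
  rw [← one_add_mul_expQuot, ← expQuot_apply]
  rfl

theorem contDiff_expMap {m : WithTop ℕ∞} : ContDiff ℝ m (expMap : C(Sph n, ℝ) → C(Sph n, ℝ)) :=
  contDiff_const.add (contDiff_id.mul contDiff_expQuot)

theorem intL_expMap_pos (hn : 3 ≤ n) (f : C(Sph n, ℝ)) : 0 < intL n (expMap f) := by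
  rw [intL_apply]
  have : Nontrivial (EuclideanSpace ℝ (Fin n)) := by
    apply Module.nontrivial_of_finrank_pos (R := ℝ)
    rw [finrank_euclideanSpace_fin]
    omega
  obtain ⟨x, hx⟩ := NormedSpace.sphere_nonempty (E := EuclideanSpace ℝ (Fin n)) (x := 0)
    (r := 1) |>.mpr zero_le_one
  refine (expMap f).continuous.integral_pos_of_hasCompactSupport_nonneg_nonzero
    (HasCompactSupport.of_compactSpace _) (fun y => ?_) (x := ⟨x, hx⟩) ?_
  · rw [expMap_apply]
    exact (Real.exp_pos _).le
  · rw [expMap_apply]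
    exact (Real.exp_pos _).ne'

/-- Subtraction of the mean value. -/
def centerL (n : ℕ) : C(Sph n, ℝ) →L[ℝ] C(Sph n, ℝ) :=
  .id ℝ _ - ((area n)⁻¹ • intL n).smulRight 1

theorem centerL_apply (f : C(Sph n, ℝ)) :
    centerL n f = f - ((area n)⁻¹ * intL n f) • (1 : C(Sph n, ℝ)) := rfl

theorem zonal_zero (e : Sph n) : zonal n e 0 = 1 := by
  ext x
  simp [zonal, gegenbauer]

theorem uniformState_eq : uniformState n = (area n)⁻¹ • ofContL n 1 := by
  rw [← map_smul]
  change ofCont n _ = ofCont n _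
  congr 1
  ext x
  simp

/-- The Gibbs map along the ray `t ↦ t x`, divided by `t`. -/
def blowUp (W : (Sph n × Sph n) →ᵇ ℝ) (t : ℝ) (x : L2 n) (γ : ℝ) : L2 n :=
  x - (intL n (expMap (t • (-γ) • convL W x)))⁻¹ •
    ofContL n (centerL n (((-γ) • convL W x) * expQuot (t • (-γ) • convL W x)))

/-- The linearization of the interaction term at the uniform state. -/
def interactionL (W : (Sph n × Sph n) →ᵇ ℝ) : L2 n →L[ℝ] L2 n :=
  (area n)⁻¹ • (ofContL n ∘L centerL n ∘L convL W)

theorem blowUp_zero (W : (Sph n × Sph n) →ᵇ ℝ) (x : L2 n) (γ : ℝ) :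
    blowUp W 0 x γ = x + γ • interactionL W x := by
  have h1 : expMap (0 : C(Sph n, ℝ)) = 1 := by simp [expMap]
  simp only [blowUp, zero_smul, h1, intL_one, expQuot_zero, mul_one, map_smul, interactionL]
  simp only [neg_smul, smul_neg, sub_neg_eq_add, smul_apply,
    ContinuousLinearMap.comp_apply]
  rw [smul_comm]

theorem contDiff_blowUp (hn : 3 ≤ n) (W : (Sph n × Sph n) →ᵇ ℝ) {m : WithTop ℕ∞} :
    ContDiff ℝ m fun q : ℝ × L2 n × ℝ => blowUp W q.1 q.2.1 q.2.2 := by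
  have ha : ContDiff ℝ m fun q : ℝ × L2 n × ℝ => (-q.2.2) • convL W q.2.1 := by fun_prop
  have hta : ContDiff ℝ m fun q : ℝ × L2 n × ℝ => q.1 • (-q.2.2) • convL W q.2.1 :=
    contDiff_fst.smul ha
  have hZ : ContDiff ℝ m fun q : ℝ × L2 n × ℝ =>
      (intL n (expMap (q.1 • (-q.2.2) • convL W q.2.1)))⁻¹ :=
    ((intL n).contDiff.comp (contDiff_expMap.comp hta)).inv fun _ => (intL_expMap_pos hn _).ne'
  exact contDiff_snd.fst.sub (hZ.smul ((ofContL n).contDiff.comp ((centerL n).contDiff.comp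
    (ha.mul (contDiff_expQuot.comp hta)))))

theorem blowUp_mem_L2s (hn : 3 ≤ n) {W : (Sph n × Sph n) →ᵇ ℝ} {e : Sph n}
    (hWe : ∀ u ∈ L2s n e, convL W u ∈ zonalCont e) {x : L2 n} (hx : x ∈ L2s n e) (t γ : ℝ) :
    blowUp W t x γ ∈ L2s n e := by
  refine Submodule.sub_mem _ hx (Submodule.smul_mem _ _ (ofCont_mem_L2s hn e ?_))
  intro y z hyz
  have h := hWe x hx y z hyz
  simp [centerL_apply, expQuot_apply, h]

section Kernel

variable {W : (Sph n × Sph n) →ᵇ ℝ} {w : ℝ → ℝ}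
  (hW : ∀ x y : Sph n, W (x, y) = w (inner ℝ x.1 y.1))

include hW

/-- The kernel convolves the uniform state to a constant; the resulting exponential factor cancels
between numerator and partition function. -/
theorem shiftedGibbsMap_eq (hn : 3 ≤ n) (hw : Continuous w) (e : Sph n) (u : L2 n) (γ : ℝ) :
    shiftedGibbsMap n W (u, γ) = uniformState n + u -
      (intL n (expMap ((-γ) • convL W u)))⁻¹ • ofContL n (expMap ((-γ) • convL W u)) := by
  set c := (area n)⁻¹ * (area n * harmonicCoeff n w 0) with hc
  have hconv : ∀ x, conv n W (uniformState n + u) x = c + convL W u x := by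
    intro x
    rw [← convL_apply, map_add, uniformState_eq, map_smul, ofContL_apply, ← zonal_zero e,
      convL_zonal hW hn hw, zonal_zero]
    simp [hc]
  have hexp : expConv n W γ (uniformState n + u) =
      Real.exp (-γ * c) • expMap ((-γ) • convL W u) := by
    ext x
    simp only [expConv, ContinuousMap.coe_mk, ContinuousMap.smul_apply, expMap_apply, hconv,
      smul_eq_mul, ← Real.exp_add]
    congr 1
    ring
  have hne : Real.exp (-γ * c) ≠ 0 := (Real.exp_pos _).ne'
  rw [shiftedGibbsMap, gibbsMap, partitionFn]
  simp only [hexp]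
  rw [← intL_apply, map_smul, smul_eq_mul, mul_inv, ← ofContL_apply, map_smul, smul_smul]
  congr 2
  field_simp

theorem contDiff_shiftedGibbsMap (hn : 3 ≤ n) (hw : Continuous w) (e : Sph n)
    {m : WithTop ℕ∞} : ContDiff ℝ m (shiftedGibbsMap n W) := by
  have h : shiftedGibbsMap n W = fun p : L2 n × ℝ => uniformState n + p.1 -
      (intL n (expMap ((-p.2) • convL W p.1)))⁻¹ •
        ofContL n (expMap ((-p.2) • convL W p.1)) := by
    funext p
    exact shiftedGibbsMap_eq hW hn hw e p.1 p.2
  have ha : ContDiff ℝ m fun p : L2 n × ℝ => (-p.2) • convL W p.1 := by fun_prop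
  rw [h]
  have hZ : ContDiff ℝ m fun p : L2 n × ℝ => (intL n (expMap ((-p.2) • convL W p.1)))⁻¹ :=
    ((intL n).contDiff.comp (contDiff_expMap.comp ha)).inv fun _ => (intL_expMap_pos hn _).ne'
  exact (contDiff_const.add contDiff_fst).sub
    (hZ.smul ((ofContL n).contDiff.comp (contDiff_expMap.comp ha)))

/-- With `a = -γ (W * x)` and `q = a * expQuot (t a)`, one has `exp(t a) = 1 + t q` and `Z = ω_n + t
∫ q`. The constant `1/ω_n - 1/Z` is thus itself `t` times the mean of `q` over `Z`, so the factor
`t` splits off with no division by `t`. -/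
theorem shiftedGibbsMap_smul (hn : 3 ≤ n) (hw : Continuous w) (e : Sph n) (t : ℝ) (x : L2 n)
    (γ : ℝ) : shiftedGibbsMap n W (t • x, γ) = t • blowUp W t x γ := by
  have harea := (area_pos hn).ne'
  rw [shiftedGibbsMap_eq hW hn hw e, blowUp, map_smul, smul_comm (-γ) t]
  set a := (-γ) • convL W x with ha
  have hZ := (intL_expMap_pos hn (t • a)).ne'
  have hexp : expMap (t • a) = 1 + t • (a * expQuot (t • a)) := by
    rw [expMap, smul_mul_assoc]
  have hint : intL n (expMap (t • a)) = area n + t * intL n (a * expQuot (t • a)) := by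
    rw [hexp, map_add, map_smul, intL_one, smul_eq_mul]
  set q := a * expQuot (t • a) with hq
  set Z := intL n (expMap (t • a)) with hZdef
  rw [hexp, uniformState_eq, centerL_apply, map_sub, map_add, map_smul, map_smul]
  have hscal : (area n)⁻¹ - Z⁻¹ - t * Z⁻¹ * ((area n)⁻¹ * intL n q) = 0 := by
    field_simp
    rw [hint]
    ring
  rw [← sub_eq_zero]
  have : ((area n)⁻¹ - Z⁻¹ - t * Z⁻¹ * ((area n)⁻¹ * intL n q)) • ofContL n 1 = 0 := by
    rw [hscal, zero_smul]
  rw [← this]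
  module

/-- Centering kills `l = 0` and fixes every other zonal harmonic, whose mean is zero by
orthogonality to `Y_{0,0}`; the factor `(area n)⁻¹` cancels the one from Funk-Hecke. -/
theorem interactionL_Y (hn : 3 ≤ n) (hw : Continuous w) (e : Sph n) (l : ℕ) :
    interactionL W (Y n e l) = (if l = 0 then 0 else harmonicCoeff n w l) • Y n e l := by
  have harea := (area_pos hn).ne'
  have hint : intL n (zonal n e l) = if l = 0 then area n else 0 := by
    have h := inner_Y hn e l 0
    have h1 := (normConst_pos hn e l).ne'
    have h2 := (normConst_pos hn e 0).ne'
    split_ifs with h0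
    · rw [h0, zonal_zero, intL_one]
    · rw [if_neg h0, Y_eq, Y_eq, real_inner_smul_left, real_inner_smul_right, inner_ofCont,
        zonal_zero] at h
      rw [intL_apply]
      simpa [h1, h2] using h
  have hcen : centerL n (zonal n e l) = (if l = 0 then (0 : ℝ) else 1) • zonal n e l := by
    rw [centerL_apply, hint]
    split_ifs with h0
    · rw [h0, zonal_zero, inv_mul_cancel₀ harea]
      simp
    · simp
  change (area n)⁻¹ • ofContL n (centerL n (convL W (Y n e l))) = _
  rw [convL_Y hW hn hw, map_smul, hcen, map_smul, map_smul, Y_eq, smul_smul, smul_smul, smul_smul,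
    ofContL_apply]
  congr 1
  split_ifs
  · simp
  · field_simp

end Kernel

/-- The normalized zonal harmonics as a Hilbert basis of the zonal subspace. -/
theorem exists_hilbertBasis_L2s (hn : 3 ≤ n) (e : Sph n) :
    ∃ b : HilbertBasis ℕ ℝ (L2s n e), ∀ l, (b l : L2 n) = (Real.sqrt (area n))⁻¹ • Y n e l := by
  have harea := area_pos hn
  have : CompleteSpace (L2s n e) :=
    (Submodule.isClosed_topologicalClosure _).completeSpace_coe
  set v : ℕ → L2s n e := fun l =>
    ⟨(Real.sqrt (area n))⁻¹ • Y n e l, Submodule.smul_mem _ _ (Y_mem_L2s e l)⟩ with hv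
  have hs : Real.sqrt (area n) ≠ 0 := (Real.sqrt_pos.mpr harea).ne'
  have hv1 : Orthonormal ℝ v := by
    rw [orthonormal_iff_ite]
    intro i j
    rw [Submodule.coe_inner, hv]
    simp only
    rw [real_inner_smul_left, real_inner_smul_right, inner_Y hn]
    split_ifs
    · rw [← mul_assoc, ← mul_inv, Real.mul_self_sqrt harea.le, inv_mul_cancel₀ harea.ne']
    · simp
  -- A zonal vector orthogonal to every `Y_{l,0}` is orthogonal to their closed span, hence to
  -- itself.
  have hv2 : (Submodule.span ℝ (range v))ᗮ = ⊥ := by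
    rw [Submodule.eq_bot_iff]
    intro x hx
    have hle : L2s n e ≤ (Submodule.span ℝ {(x : L2 n)})ᗮ := by
      refine Submodule.topologicalClosure_minimal _ (Submodule.span_le.mpr ?_)
        (Submodule.isClosed_orthogonal _)
      rintro _ ⟨l, rfl⟩
      rw [SetLike.mem_coe, Submodule.mem_orthogonal_singleton_iff_inner_left]
      have h := hx (v l) (Submodule.subset_span ⟨l, rfl⟩)
      rw [Submodule.coe_inner] at h
      change inner ℝ ((Real.sqrt (area n))⁻¹ • Y n e l) (x : L2 n) = 0 at h
      rw [real_inner_smul_left] at h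
      exact (mul_eq_zero.mp h).resolve_left (inv_ne_zero hs)
    have h := hle x.2
    rw [Submodule.mem_orthogonal_singleton_iff_inner_left, inner_self_eq_zero] at h
    exact Subtype.ext h
  exact ⟨HilbertBasis.mkOfOrthogonalEqBot hv1 hv2, fun l => by
    rw [HilbertBasis.coe_mkOfOrthogonalEqBot]⟩

/-! ### The bifurcating curve -/

theorem exists_pos_le_abs_of_tendsto {d : ℕ → ℝ} (hd : ∀ l, d l ≠ 0) {a : ℝ} (ha : a ≠ 0)
    (h : Filter.Tendsto d Filter.atTop (nhds a)) : ∃ c > 0, ∀ l, c ≤ |d l| := by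
  obtain ⟨B, hB⟩ := (h.abs.inv₀ (abs_ne_zero.mpr ha)).bddAbove_range
  have hB' : ∀ l, |d l|⁻¹ ≤ B := fun l => hB ⟨l, rfl⟩
  have hpos : ∀ l, 0 < |d l| := fun l => abs_pos.mpr (hd l)
  have hB0 : 0 < B := (inv_pos.mpr (hpos 0)).trans_le (hB' 0)
  exact ⟨B⁻¹, inv_pos.mpr hB0, fun l => (inv_le_comm₀ hB0 (hpos l)).mpr (hB' l)⟩

/-- The term `ℓ.smulRight (K y)` comes from varying the parameter; it restores invertibility in the
kernel direction. -/
theorem hasFDerivAt_reduced {H X : Type*} [NormedAddCommGroup H] [NormedSpace ℝ H]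
    [NormedAddCommGroup X] [NormedSpace ℝ X] (π : H →L[ℝ] X) (ζ : X →L[ℝ] H) (K : H →L[ℝ] H)
    (ℓ : X →L[ℝ] ℝ) (y : H) (γ : ℝ) :
    HasFDerivAt (fun v => π ((y + ζ v) + (γ + ℓ v) • K (y + ζ v)))
      (π ∘L (ζ + (γ • (K ∘L ζ) + ℓ.smulRight (K y)))) 0 := by
  have h1 : HasFDerivAt (fun v => y + ζ v) ζ 0 := ζ.hasFDerivAt.const_add y
  have h2 : HasFDerivAt (fun v => K (y + ζ v)) (K ∘L ζ) 0 := K.hasFDerivAt.comp 0 h1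
  have h3 : HasFDerivAt (fun v => γ + ℓ v) ℓ 0 := ℓ.hasFDerivAt.const_add γ
  have h4 := π.hasFDerivAt.comp 0 (h1.add (h3.smul h2))
  simp only [map_zero, add_zero] at h4
  exact h4

/-- The splitting of the zonal subspace into the line through `Y_{k,0}` and its complement. -/
theorem exists_splitting (hn : 3 ≤ n) (e : Sph n) (k : ℕ) :
    ∃ (ℓ : L2s n e →L[ℝ] ℝ) (ζ : L2s n e →L[ℝ] L2 n), (∀ v, ζ v ∈ L2s n e) ∧
      (∀ v, inner ℝ (Y n e k) (ζ v) = 0) ∧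
      ∀ (l : ℕ) (c : ℝ) (v : L2s n e), (v : L2 n) = c • Y n e l →
        ℓ v = (if k = l then c else 0) ∧ ζ v = if k = l then 0 else c • Y n e l := by
  have harea := (area_pos hn).ne'
  have hYY : ∀ l, (area n)⁻¹ * inner ℝ (Y n e k) (Y n e l) = if k = l then 1 else 0 := by
    intro l
    rw [inner_Y hn]
    split_ifs
    · exact inv_mul_cancel₀ harea
    · exact mul_zero _
  obtain ⟨ℓ, hℓ⟩ : ∃ ℓ : L2s n e →L[ℝ] ℝ,
      ∀ v, ℓ v = (area n)⁻¹ * inner ℝ (Y n e k) (v : L2 n) :=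
    ⟨((area n)⁻¹ • innerSL ℝ (Y n e k)) ∘L (L2s n e).subtypeL, fun v => rfl⟩
  obtain ⟨ζ, hζ⟩ : ∃ ζ : L2s n e →L[ℝ] L2 n, ∀ v, ζ v = (v : L2 n) - ℓ v • Y n e k :=
    ⟨(L2s n e).subtypeL - ℓ.smulRight (Y n e k), fun v => rfl⟩
  refine ⟨ℓ, ζ, fun v => ?_, fun v => ?_, fun l c v hv => ?_⟩
  · rw [hζ]
    exact Submodule.sub_mem _ v.2 (Submodule.smul_mem _ _ (Y_mem_L2s e k))
  · rw [hζ, inner_sub_right, real_inner_smul_right, hℓ, inner_Y hn, if_pos rfl]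
    field_simp
    ring
  · have h1 : ℓ v = if k = l then c else 0 := by
      rw [hℓ, hv, real_inner_smul_right, mul_left_comm, hYY]
      split_ifs <;> simp
    refine ⟨h1, ?_⟩
    rw [hζ, h1, hv]
    split_ifs with h
    · rw [h, sub_self]
    · rw [zero_smul, sub_zero]

/-- The implicit function theorem is applied to `v ↦ Φ(t, Y_k + ζ v, γ_k + ℓ v)` on the zonal
subspace, with `z = ζ v` and `μ = ℓ v`. -/
theorem exists_solution_curve (hn : 3 ≤ n) {W : (Sph n × Sph n) →ᵇ ℝ} {w : ℝ → ℝ}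
    (hW : ∀ x y : Sph n, W (x, y) = w (inner ℝ x.1 y.1)) (hw : Continuous w)
    (k : ℕ) (hk : 1 ≤ k) (hneg : harmonicCoeff n w k < 0)
    (huniq : ∀ j : ℕ, 1 ≤ j → j ≠ k → harmonicCoeff n w j ≠ harmonicCoeff n w k)
    (e : Sph n) (γk : ℝ) (hγk : γk = -1 / harmonicCoeff n w k) :
    ∃ (δ : ℝ) (z : ℝ → L2 n) (μ : ℝ → ℝ), 0 < δ ∧ ContinuousOn z (Ioo (-δ) δ) ∧
      ContinuousOn μ (Ioo (-δ) δ) ∧ z 0 = 0 ∧ μ 0 = 0 ∧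
      ∀ t ∈ Ioo (-δ) δ, 0 < γk + μ t ∧ z t ∈ L2s n e ∧ inner ℝ (Y n e k) (z t) = 0 ∧
        shiftedGibbsMap n W (t • Y n e k + t • z t, γk + μ t) = 0 := by
  have : CompleteSpace (L2s n e) :=
    (Submodule.isClosed_topologicalClosure _).completeSpace_coe
  have hγpos : 0 < γk := by rw [hγk]; exact div_pos_of_neg_of_neg (by norm_num) hneg
  have hblow : ∀ t x γ, x ∈ L2s n e → blowUp W t x γ ∈ L2s n e := fun t x γ hx =>
    blowUp_mem_L2s hn (fun u hu => convL_mem_zonalCont hW hn hw e hu) hx t γ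
  have hKY := interactionL_Y hW hn hw e
  have hsmul := shiftedGibbsMap_smul hW hn hw e
  have hbz := blowUp_zero W
  have hbc := contDiff_blowUp hn W (m := 1)
  generalize interactionL W = K at hKY hbz
  generalize blowUp W = Φ at hblow hsmul hbz hbc
  have hKYk : K (Y n e k) = harmonicCoeff n w k • Y n e k := by
    rw [hKY, if_neg (by omega)]
  -- The projection only makes the reduced map take values in the subspace; on zonal arguments the
  -- blow-up is already zonal, so no equation is lost.
  obtain ⟨π, hπ⟩ : ∃ π : L2 n →L[ℝ] L2s n e, ∀ u : L2s n e, π (u : L2 n) = u :=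
    ⟨(L2s n e).orthogonalProjectionOnto, fun u =>
      (L2s n e).orthogonalProjectionOnto_mem_subspace_eq_self u⟩
  obtain ⟨ℓ, ζ, hζmem, hζorth, hℓζ⟩ := exists_splitting hn e k
  have hΨc : ContDiff ℝ 1 fun q : ℝ × L2s n e =>
      π (Φ q.1 (Y n e k + ζ q.2) (γk + ℓ q.2)) := by
    have h1 : ContDiff ℝ 1 fun q : ℝ × L2s n e => (q.1, Y n e k + ζ q.2, γk + ℓ q.2) := by
      fun_prop
    have h2 := hbc.comp h1
    exact π.contDiff.comp h2
  have hΨ0 : π (Φ (0 : ℝ × L2s n e).1 (Y n e k + ζ (0 : ℝ × L2s n e).2)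
      (γk + ℓ (0 : ℝ × L2s n e).2)) = 0 := by
    have h1 : Y n e k + γk • K (Y n e k) = 0 := by
      rw [hKYk, smul_smul, hγk, div_mul_cancel₀ _ hneg.ne]
      module
    rw [Prod.fst_zero, Prod.snd_zero, map_zero, map_zero, add_zero, add_zero, hbz, h1, map_zero]
  have hDeriv := hasFDerivAt_reduced π ζ K ℓ (Y n e k) γk
  simp only [← hbz] at hDeriv
  set D := π ∘L (ζ + (γk • (K ∘L ζ) + ℓ.smulRight (K (Y n e k)))) with hD
  have hDa : ∀ v, D v = π (ζ v + (γk • K (ζ v) + ℓ v • K (Y n e k))) := fun v => rfl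
  obtain ⟨b, hb⟩ := exists_hilbertBasis_L2s hn e
  -- At `l = k` the perturbation moves only the parameter, giving `Ŵ_k`; elsewhere it moves only the
  -- state, giving the linearization at `γ_k`.
  set d : ℕ → ℝ := fun l => if k = l then harmonicCoeff n w k else
    1 + γk * (if l = 0 then 0 else harmonicCoeff n w l) with hd
  have hDb : ∀ l, D (b l) = d l • b l := by
    intro l
    obtain ⟨h1, h2⟩ := hℓζ l _ (b l) (hb l)
    rw [← hπ (d l • b l), hDa, Submodule.coe_smul, hb, h1, h2, hd]
    congr 1
    simp only
    split_ifs with h h0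
    · subst h
      rw [map_zero, hKYk]
      module
    · rw [map_smul, hKY, if_pos h0]
      module
    · rw [map_smul, hKY, if_neg h0]
      module
  have hd0 : ∀ l, d l ≠ 0 := by
    intro l
    simp only [hd]
    split_ifs with h h0
    · exact hneg.ne
    · simp
    · have hne := huniq l (by omega) (Ne.symm h)
      rw [hγk]
      intro h'
      apply hne
      have := hneg.ne
      field_simp at h'
      linarith
  have hdlim : Filter.Tendsto d Filter.atTop (nhds 1) := by
    have h1 := ((tendsto_harmonicCoeff hn e hw).const_mul γk).const_add 1
    rw [mul_zero, add_zero] at h1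
    refine h1.congr' ?_
    filter_upwards [Filter.eventually_gt_atTop k] with l hl
    simp only [hd]
    rw [if_neg hl.ne, if_neg (by omega)]
  obtain ⟨c, hc, hcd⟩ := exists_pos_le_abs_of_tendsto hd0 one_ne_zero hdlim
  obtain ⟨δ, hδ, v, hvc, hv0, hv⟩ := exists_implicit_curve hΨc hΨ0 hDeriv
    (bijective_of_diagonal b D d hDb hc hcd)
  have hμc : ContinuousOn (fun t => ℓ (v t)) (Ioo (-δ) δ) :=
    ℓ.continuous.comp_continuousOn hvc
  have hμ0 : ℓ (v 0) = 0 := by rw [hv0, map_zero]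
  have hev : ∀ᶠ t in nhds (0 : ℝ), 0 < γk + ℓ (v t) := by
    have h1 : ContinuousAt (fun t => γk + ℓ (v t)) 0 :=
      continuousAt_const.add (hμc.continuousAt (Ioo_mem_nhds (neg_lt_zero.mpr hδ) hδ))
    refine h1.eventually (lt_mem_nhds ?_)
    simp only [hμ0, add_zero]
    exact hγpos
  obtain ⟨η, hη, hball⟩ := Metric.eventually_nhds_iff_ball.mp hev
  -- The interval is shrunk so that the parameter stays positive.
  have hsub : Ioo (-(min δ η)) (min δ η) ⊆ Ioo (-δ) δ :=
    Ioo_subset_Ioo (neg_le_neg (min_le_left _ _)) (min_le_left _ _)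
  refine ⟨min δ η, fun t => ζ (v t), fun t => ℓ (v t), lt_min hδ hη,
    (ζ.continuous.comp_continuousOn hvc).mono hsub, hμc.mono hsub, ?_, hμ0, ?_⟩
  · simp only [hv0, map_zero]
  · intro t ht
    refine ⟨hball t ?_, hζmem _, hζorth _, ?_⟩
    · rw [Real.ball_eq_Ioo, zero_sub, zero_add]
      exact ⟨(neg_le_neg (min_le_right _ _)).trans_lt ht.1, ht.2.trans_le (min_le_right _ _)⟩
    · rw [← smul_add, hsmul]
      -- The blow-up lies in the zonal subspace, where `π` is the identity, so vanishing of its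
      -- projection is vanishing of the blow-up itself.
      have hm := hblow t _ (γk + ℓ (v t)) (Submodule.add_mem _ (Y_mem_L2s e k) (hζmem (v t)))
      have h2 := (hπ ⟨_, hm⟩).symm.trans (hv t (hsub ht))
      have h3 : Φ t (Y n e k + ζ (v t)) (γk + ℓ (v t)) = 0 := congrArg Subtype.val h2
      simp only [h3, smul_zero]

end SphereGibbs

end

theorem theorem4 (n : ℕ) (hn : 3 ≤ n)
    (W : (SphereGibbs.Sph n × SphereGibbs.Sph n) →ᵇ ℝ) (w : ℝ → ℝ)
    (hW : ∀ x y : SphereGibbs.Sph n,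
      W (x, y) = w (inner ℝ (x : EuclideanSpace ℝ (Fin n)) (y : EuclideanSpace ℝ (Fin n))))
    (k : ℕ) (hk : 1 ≤ k)
    (hneg : SphereGibbs.harmonicCoeff n w k < 0)
    (huniq : ∀ j : ℕ, 1 ≤ j → j ≠ k →
      SphereGibbs.harmonicCoeff n w j ≠ SphereGibbs.harmonicCoeff n w k)
    (e : SphereGibbs.Sph n) (γk : ℝ) (hγk : γk = -1 / SphereGibbs.harmonicCoeff n w k) :
    SphereGibbs.IsBifurcationPoint (SphereGibbs.shiftedGibbsMap n W) (univ ×ˢ Ioi (0 : ℝ))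
        ((0 : SphereGibbs.L2 n), γk) ∧
      ∃ (δ : ℝ) (z : ℝ → SphereGibbs.L2 n) (μ : ℝ → ℝ),
        0 < δ ∧ ContinuousOn z (Ioo (-δ) δ) ∧ ContinuousOn μ (Ioo (-δ) δ) ∧
        z 0 = 0 ∧ μ 0 = 0 ∧
        SphereGibbs.IsBifurcationCurve (SphereGibbs.shiftedGibbsMap n W)
          (univ ×ˢ Ioi (0 : ℝ)) ((0 : SphereGibbs.L2 n), γk) δ
          (fun t => (t • SphereGibbs.Y n e k + t • z t, γk + μ t)) ∧
        ∀ t ∈ Ioo (-δ) δ, t • SphereGibbs.Y n e k + t • z t ∈ SphereGibbs.L2s n e := by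
  obtain ⟨v, hv, hWv, hcoeff⟩ := SphereGibbs.exists_continuous_profile hn e hW
  rw [← hcoeff] at hneg hγk
  simp only [← hcoeff] at huniq
  obtain ⟨δ, z, μ, hδ, hz, hμ, hz0, hμ0, hcurve⟩ :=
    SphereGibbs.exists_solution_curve hn hWv hv k hk hneg huniq e γk hγk
  have harea := SphereGibbs.area_pos hn
  have hmem0 : (0 : ℝ) ∈ Ioo (-δ) δ := ⟨neg_lt_zero.mpr hδ, hδ⟩
  have hS : ContinuousOn (fun t => (t • SphereGibbs.Y n e k + t • z t, γk + μ t)) (Ioo (-δ) δ) := by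
    fun_prop
  have hS0 : (0 • SphereGibbs.Y n e k + (0 : ℝ) • z 0, γk + μ 0) =
      ((0 : SphereGibbs.L2 n), γk) := by
    rw [hμ0, zero_smul, zero_smul, add_zero, add_zero]
  have hbif : SphereGibbs.IsBifurcationPoint (SphereGibbs.shiftedGibbsMap n W)
      (univ ×ˢ Ioi (0 : ℝ)) ((0 : SphereGibbs.L2 n), γk) := by
    refine ⟨isOpen_univ.prod isOpen_Ioi, ⟨mem_univ _, ?_⟩,
      (SphereGibbs.contDiff_shiftedGibbsMap hWv hn hv e).contDiffOn, ?_⟩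
    · simpa [hμ0] using (hcurve 0 hmem0).1
    · have hlim : Filter.Tendsto (fun t => (t • SphereGibbs.Y n e k + t • z t, γk + μ t))
          (nhdsWithin 0 (Ioi 0)) (nhds ((0 : SphereGibbs.L2 n), γk)) := by
        have h := (hS.continuousAt (Ioo_mem_nhds hmem0.1 hmem0.2)).tendsto
        simp only [hμ0, zero_smul, add_zero] at h
        exact h.mono_left nhdsWithin_le_nhds
      refine mem_closure_of_tendsto hlim ?_
      filter_upwards [Ioo_mem_nhdsGT hδ] with t ht
      obtain ⟨h1, -, h3, h4⟩ := hcurve t ⟨hmem0.1.trans ht.1, ht.2⟩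
      refine ⟨⟨mem_univ _, h1⟩, h4, fun h => ?_⟩
      -- Pairing the state with `Y_k` gives `t * area n`, as `z t` is orthogonal to `Y_k`; this is
      -- nonzero for `t > 0`, so the solutions are nontrivial.
      have h5 := congrArg (fun u => inner ℝ (SphereGibbs.Y n e k) u) h
      simp only [inner_add_right, real_inner_smul_right, h3, inner_zero_right,
        SphereGibbs.inner_Y hn, if_true, mul_zero, add_zero] at h5
      exact (mul_pos ht.1 harea).ne' h5
  refine ⟨hbif, δ, z, μ, hδ, hz, hμ, hz0, hμ0, ⟨hbif, hδ, hS, ?_, fun t ht => ?_⟩, fun t ht => ?_⟩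
  · simp only [hμ0, zero_smul, add_zero]
  · obtain ⟨h1, -, -, h4⟩ := hcurve t ht
    exact ⟨⟨mem_univ _, h1⟩, h4⟩
  · exact Submodule.add_mem _ (Submodule.smul_mem _ _ (SphereGibbs.Y_mem_L2s e k))
      (Submodule.smul_mem _ _ (hcurve t ht).2.1)
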